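/- Let $p\in(0,1]$ and let $X$, $\xi$ be real random variables with $\mathbb P(X=0)<1$, $\mathbb P(\xi=0)<1$, $\xi\ge 0$ almost surely, and $X,\xi\in L^\alpha(\mathbb P)$ for some $\alpha>1$. Write $m_1=\mathbb E\,\xi$, and $0\log 0=0$. Let $(X_n)_{n\ge1}$, $(\varepsilon_n)_{n\ge2}$, $(\mathcal U[n])_{n\ge2}$, $(\xi_n)_{n\ge2}$ be mutually independent random variables such that each $X_n$ is distributed as $X$, each $\varepsilon_n$ is Bernoulli$(p)$, $\mathcal U[n]$ is uniform on $\{1,\dots,n-1\}$ and each $\xi_n$ is distributed as $\xi$. The random walk with echoed steps is $\tilde S_n=\tilde X_1+\cdots+\tilde X_n$, $n\ge 1$, where $$\tilde X_1=X_1,\qquad \tilde X_n=(1-\varepsilon_n)X_n+\varepsilon_n\,\xi_n\,\tilde X_{\mathcal U[n]}\quad(n\ge2).$$ **Theorem 2.** If $pm_1\le1$, there exists $\gamma>1$, depending only on $p$ and the laws of $X$ and $\xi$, such that: i) If $pm_1=1$ and $\mathbb E[\xi\log\xi]<m_1$, then $$\lim_{n\to\infty}\frac{\tilde S_n}{n\log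 n}=(1-p)\,\mathbb E X\quad\text{a.s. and in }L^\gamma(\mathbb P).$$ ii) If $pm_1<1$, then $$\lim_{n\to\infty}\frac{\tilde S_n}{n}=\frac{(1-p)\,\mathbb E X}{1-pm_1}\quad\text{a.s. and in }L^\gamma(\mathbb P).$$ -/

import Mathlib

open MeasureTheory ProbabilityTheory Filter Topology

/-- The increments of the random walk with echoed steps (times start at `1`). At time `1` the
increment is `X 1`; at time `n ≥ 2` it is
`(1 - ε n) * X n + ε n * ξ n * (increment at the remembered time U n)`.
The remembered time lies in `{1, …, n - 1}` almost surely; the value `0` in the inner `else` branch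
only serves to make the recursion total on the exceptional null set, and the index `0` is not
used by the model. -/
def echoStep {Ω : Type*} (X ε ξ : ℕ → Ω → ℝ) (U : ℕ → Ω → ℕ) (n : ℕ) (ω : Ω) : ℝ :=
  if n ≤ 1 then X n ω
  else (1 - ε n ω) * X n ω +
    ε n ω * ξ n ω *
      (if _h : 1 ≤ U n ω ∧ U n ω < n then echoStep X ε ξ U (U n ω) ω else 0)
termination_by n
decreasing_by exact _h.2

/-- The position at time `n` of the random walk with echoed steps. -/
noncomputable def echoWalk {Ω : Type*} (X ε ξ : ℕ → Ω → ℝ) (U : ℕ → Ω → ℕ) (n : ℕ) (ω : Ω) : ℝ :=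
  ∑ k ∈ Finset.Icc 1 n, echoStep X ε ξ U k ω

/-- The family of all the driving variables `X_n` (`n ≥ 1`), `ε_n`, `U[n]`, `ξ_n` (`n ≥ 2`),
the natural numbers `U[n]` being read as real numbers. -/
def drivingFamily {Ω : Type*} (X ε ξ : ℕ → Ω → ℝ) (U : ℕ → Ω → ℕ) :
    ({n : ℕ // 1 ≤ n} ⊕ {n : ℕ // 2 ≤ n} ⊕ {n : ℕ // 2 ≤ n} ⊕ {n : ℕ // 2 ≤ n}) → Ω → ℝ :=
  Sum.elim (fun n => X n) (Sum.elim (fun n => ε n)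
    (Sum.elim (fun n ω => (U n ω : ℝ)) (fun n => ξ n)))

/-- The driving variables of a random walk with echoed steps with memory parameter `p`,
spin law `νX` and echo law `νξ`. -/
structure IsEchoInput {Ω : Type*} [MeasurableSpace Ω] (μ : Measure Ω) (p : ℝ)
    (νX νξ : Measure ℝ) (X ε ξ : ℕ → Ω → ℝ) (U : ℕ → Ω → ℕ) : Prop where
  measurable_spin : ∀ n, 1 ≤ n → Measurable (X n)
  measurable_bern : ∀ n, 2 ≤ n → Measurable (ε n)
  measurable_echo : ∀ n, 2 ≤ n → Measurable (ξ n)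
  measurable_unif : ∀ n, 2 ≤ n → Measurable (U n)
  /-- The spins have law `νX`. -/
  law_spin : ∀ n, 1 ≤ n → μ.map (X n) = νX
  /-- The echo variables have law `νξ`. -/
  law_echo : ∀ n, 2 ≤ n → μ.map (ξ n) = νξ
  /-- `ε_n` is Bernoulli with parameter `p`. -/
  law_bern_one : ∀ n, 2 ≤ n → μ {ω | ε n ω = 1} = ENNReal.ofReal p
  law_bern_zero : ∀ n, 2 ≤ n → μ {ω | ε n ω = 0} = ENNReal.ofReal (1 - p)
  /-- `U[n]` is uniform on `{1, …, n - 1}`. -/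
  law_unif : ∀ n, 2 ≤ n → ∀ k, 1 ≤ k → k < n → μ {ω | U n ω = k} = ((n - 1 : ℕ) : ENNReal)⁻¹
  /-- All the driving variables are mutually independent. -/
  indep : iIndepFun (drivingFamily X ε ξ U) μ

/-- `Z n → c` almost surely and in `L^γ(μ)`. -/
def TendstoASAndLp {Ω : Type*} [MeasurableSpace Ω] (μ : Measure Ω) (γ : ℝ)
    (Z : ℕ → Ω → ℝ) (c : ℝ) : Prop :=
  (∀ᵐ ω ∂μ, Tendsto (fun n => Z n ω) atTop (𝓝 c)) ∧
  (∀ n, MemLp (Z n) (ENNReal.ofReal γ) μ) ∧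
  Tendsto (fun n => eLpNorm (fun ω => Z n ω - c) (ENNReal.ofReal γ) μ) atTop (𝓝 0)

/-! Given the past, the next increment has mean `c + q *` (average of the past increments), with `c
= (1 - p) E X` and `q = p E ξ`. As `ε` is 0 or 1, the `γ`-th absolute power of the increment obeys a
rule of the same form, with slope `ρ = p E ξ^γ`. Hence the average `A n` of the first `n + 1`
increments satisfies `A (n+1) = (1 - (1-q)/(n+2)) A n + c/(n+2) + D n`, where the `D n` are
martingale differences (`IsAveraging.average_succ`).

Everything rests on the summability of `E|D n|^γ`. The moment recursion makes the summed `γ`-moments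
grow at most like `n^r` for every `r ≥ 1` with `r > ρ`, so `E|D n|^γ = O(n^(r-1-γ))`, which is
summable if `r < γ`. One thus needs `γ > 1` with `p E ξ^γ < γ`. For `γ` near 1 this holds by
continuity when `q < 1`. When `q = 1` the two sides agree at `γ = 1`, and comparing their right
derivatives gives exactly the condition on `E[ξ log ξ]` (`exists_exponent`).

A von Bahr–Esseen type inequality then shows that the martingale `∑ D` is bounded in `L^γ` and
converges almost surely. If `q < 1`, the recursion contracts towards its fixed point `c/(1-q)` and
forgets convergent perturbations (`tendsto_zero_of_contraction`). If `q = 1`, there is no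
contraction: the average is `c` times a harmonic sum plus the first increment plus the martingale,
and only the harmonic sum survives division by `log n`. -/

/-! ### Elementary inequalities for powers -/

/-- First-order expansion of `|·|^γ` at `a`: the linear term will vanish in conditional mean. By
homogeneity it suffices to treat `a = 1`; Bernoulli's inequality with exponent `γ - 1 ≤ 1` handles
`|t| ≤ 1`, and `4 = 2^2` covers large `t`. For `a = 0` the linear term is 0, by the convention on
division. -/
theorem abs_add_rpow_le {γ : ℝ} (h1 : 1 ≤ γ) (h2 : γ ≤ 2) (a b : ℝ) :
    |a + b| ^ γ ≤ |a| ^ γ + γ * (|a| ^ γ / a * b) + 4 * |b| ^ γ := by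
  have hscaled (t : ℝ) : |1 + t| ^ γ ≤ 1 + γ * t + 4 * |t| ^ γ := by
    have ht0 : 0 ≤ |t| ^ γ := by positivity
    rcases le_or_gt t (-1) with ht | ht
    · have h3 : |1 + t| ^ γ ≤ |t| ^ γ := by
        apply Real.rpow_le_rpow (abs_nonneg _) _ (by linarith)
        rw [abs_of_nonpos (by linarith), abs_of_neg (by linarith)]; linarith
      have h4 : |t| ≤ |t| ^ γ := by
        apply Real.self_le_rpow_of_one_le _ h1
        rw [abs_of_neg (by linarith)]; linarith
      have h5 : |t| = -t := abs_of_neg (by linarith)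
      nlinarith
    rcases le_or_gt t 1 with ht' | ht'
    · have h3 : (1 + t) ^ γ = (1 + t) * (1 + t) ^ (γ - 1) := by
        rw [← Real.rpow_one_add' (by linarith) (by linarith)]; congr 1; ring
      have h4 := rpow_one_add_le_one_add_mul_self ht.le (p := γ - 1) (by linarith) (by linarith)
      have h5 : t ^ 2 ≤ |t| ^ γ := by
        rw [← sq_abs, ← Real.rpow_two]
        rcases eq_or_ne t 0 with rfl | h0
        · simp; rw [Real.zero_rpow (by linarith)]
        · exact Real.rpow_le_rpow_of_exponent_ge (abs_pos.2 h0) (abs_le.2 ⟨ht.le, ht'⟩) h2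
      rw [abs_of_nonneg (by linarith), h3]
      have := mul_le_mul_of_nonneg_left h4 (show 0 ≤ 1 + t by linarith)
      nlinarith [sq_nonneg t]
    · have h3 : |1 + t| ^ γ ≤ (2 * |t|) ^ γ := by
        apply Real.rpow_le_rpow (abs_nonneg _) _ (by linarith)
        rw [abs_of_pos (by linarith), abs_of_pos (by linarith)]; linarith
      rw [Real.mul_rpow (by norm_num) (abs_nonneg _)] at h3
      have h4 : (2 : ℝ) ^ γ ≤ 2 ^ (2 : ℝ) :=
        Real.rpow_le_rpow_of_exponent_le (by norm_num) h2
      norm_num at h4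
      nlinarith
  rcases eq_or_ne a 0 with rfl | ha
  · have : 0 ≤ |b| ^ γ := by positivity
    simp [Real.zero_rpow (show γ ≠ 0 by linarith)]
    linarith
  · have h := mul_le_mul_of_nonneg_left (hscaled (b / a)) (show 0 ≤ |a| ^ γ by positivity)
    have e1 : |a| ^ γ * |1 + b / a| ^ γ = |a + b| ^ γ := by
      rw [← Real.mul_rpow (abs_nonneg _) (abs_nonneg _), ← abs_mul]
      congr 2; field_simp
    have e2 : |a| ^ γ * |b / a| ^ γ = |b| ^ γ := by
      rw [← Real.mul_rpow (abs_nonneg _) (abs_nonneg _), ← abs_mul]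
      congr 2; field_simp
    rw [e1] at h
    calc _ ≤ _ := h
      _ = |a| ^ γ + γ * (|a| ^ γ / a * b) + 4 * (|a| ^ γ * |b / a| ^ γ) := by ring
      _ = _ := by rw [e2]

theorem abs_rpow_div_mul_le {γ : ℝ} (h1 : 1 ≤ γ) (a b : ℝ) :
    |(|a| ^ γ / a * b)| ≤ |a| ^ γ + |b| ^ γ := by
  have hb : 0 ≤ |b| ^ γ := by positivity
  have ha : 0 ≤ |a| ^ γ := by positivity
  rcases eq_or_ne a 0 with rfl | h0
  · simpa using add_nonneg ha hb
  have hp : 0 < |a| := abs_pos.2 h0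
  rw [abs_mul, abs_div, abs_of_nonneg ha]
  rcases le_total |b| |a| with h | h
  · have : |a| ^ γ / |a| * |b| ≤ |a| ^ γ / |a| * |a| := by gcongr
    rw [div_mul_cancel₀ _ hp.ne'] at this
    linarith
  · have hbp : 0 < |b| := hp.trans_le h
    have : |a| ^ γ / |a| * |b| ≤ |b| ^ γ / |b| * |b| := by
      rw [← Real.rpow_sub_one hp.ne', ← Real.rpow_sub_one hbp.ne']
      gcongr
    rw [div_mul_cancel₀ _ hbp.ne'] at this
    linarith

/-! ### Recursions on real sequences -/

theorem tendsto_prod_one_sub_div_zero {θ : ℝ} (h0 : 0 < θ) (h1 : θ ≤ 1) (N : ℕ) :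
    Tendsto (fun n : ℕ => ∏ k ∈ Finset.range n, (1 - θ / ((N + k : ℕ) + 2 : ℝ))) atTop (𝓝 0) := by
  have hsum : Tendsto (fun n => ∑ k ∈ Finset.range n, (1 / ((N + k : ℕ) + 2 : ℝ))) atTop atTop := by
    have h := (Real.tendsto_sum_range_one_div_nat_succ_atTop).comp
      (tendsto_add_atTop_nat (N + 1))
    have h' := tendsto_atTop_add_const_right atTop
      (-∑ k ∈ Finset.range (N + 1), (1 / ((k : ℝ) + 1))) h
    refine h'.congr fun n => ?_
    simp only [Function.comp]
    rw [add_comm n (N + 1), Finset.sum_range_add, add_comm, neg_add_cancel_left]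
    refine Finset.sum_congr rfl fun k _ => ?_
    push_cast; congr 1; ring
  have hexp : Tendsto (fun n => Real.exp (-(θ * ∑ k ∈ Finset.range n,
      (1 / ((N + k : ℕ) + 2 : ℝ))))) atTop (𝓝 0) :=
    Real.tendsto_exp_neg_atTop_nhds_zero.comp (hsum.const_mul_atTop h0)
  have hle (k : ℕ) : θ / ((N + k : ℕ) + 2 : ℝ) ≤ 1 := by
    rw [div_le_one (by positivity)]
    have : (0 : ℝ) ≤ (N + k : ℕ) := by positivity
    linarith
  refine squeeze_zero (fun n => Finset.prod_nonneg fun k _ => by linarith [hle k]) (fun n => ?_) hexp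
  rw [Finset.mul_sum, ← Finset.sum_neg_distrib, Real.exp_sum]
  refine Finset.prod_le_prod (fun k _ => by linarith [hle k]) fun k _ => ?_
  have := Real.add_one_le_exp (-(θ * (1 / ((N + k : ℕ) + 2 : ℝ))))
  rw [mul_one_div] at this ⊢
  linarith

theorem tendsto_zero_of_contraction {θ : ℝ} (h0 : 0 < θ) (h1 : θ ≤ 1) {w d : ℕ → ℝ} {l : ℝ}
    (hw : ∀ n : ℕ, w (n + 1) = (1 - θ / (n + 2 : ℝ)) * w n + d n)
    (hd : Tendsto (fun n => ∑ k ∈ Finset.range n, d k) atTop (𝓝 l)) :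
    Tendsto w atTop (𝓝 0) := by
  set D := fun n => ∑ k ∈ Finset.range n, d k with hD
  have hpos (n : ℕ) : 0 ≤ θ / (n + 2 : ℝ) := by positivity
  have hle (n : ℕ) : θ / (n + 2 : ℝ) ≤ 1 := by
    rw [div_le_one (by positivity)]
    have : (0 : ℝ) ≤ n := by positivity
    linarith
  -- Removing the partial sums leaves a convex combination of `z n` with `l - D n`, which tends to
  -- 0. No absolute convergence of the perturbations is needed.
  let z := fun n => w n - D n + l
  have hz (n : ℕ) : z (n + 1) = (1 - θ / (n + 2 : ℝ)) * z n + θ / (n + 2 : ℝ) * (l - D n) := by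
    simp only [z, hw, hD, Finset.sum_range_succ]; ring
  suffices hz0 : Tendsto z atTop (𝓝 0) by
    have := (hz0.add hd).sub_const l
    simp only [zero_add, sub_self] at this
    refine this.congr fun n => ?_
    simp only [z, hD]; ring
  rw [Metric.tendsto_atTop]
  intro e he
  obtain ⟨N, hN⟩ := Metric.tendsto_atTop.1 hd (e / 2) (by positivity)
  have hbound (n : ℕ) : |z (N + n)| - e / 2 ≤
      (∏ k ∈ Finset.range n, (1 - θ / ((N + k : ℕ) + 2 : ℝ))) * |z N| := by
    induction n with
    | zero => simp; linarith
    | succ n ih =>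
      have h2 := hN (N + n) (by omega)
      rw [Real.dist_eq, abs_sub_comm] at h2
      have h3 : |z (N + n + 1)| ≤ (1 - θ / ((N + n : ℕ) + 2 : ℝ)) * |z (N + n)|
          + θ / ((N + n : ℕ) + 2 : ℝ) * (e / 2) := by
        rw [hz]
        refine (abs_add_le _ _).trans ?_
        rw [abs_mul, abs_mul, abs_of_nonneg (hpos _), abs_of_nonneg (by linarith [hle (N + n)])]
        have := mul_le_mul_of_nonneg_left h2.le (hpos (N + n))
        linarith
      rw [Finset.prod_range_succ, ← add_assoc]
      have h4 := mul_le_mul_of_nonneg_left ih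
        (show 0 ≤ 1 - θ / ((N + n : ℕ) + 2 : ℝ) by linarith [hle (N + n)])
      linarith
  have hlim := (tendsto_prod_one_sub_div_zero h0 h1 N).mul_const |z N|
  rw [zero_mul] at hlim
  obtain ⟨n₀, hn₀⟩ := eventually_atTop.1 (hlim.eventually (gt_mem_nhds (half_pos he)))
  refine ⟨N + n₀, fun m hm => ?_⟩
  obtain ⟨j, rfl⟩ := Nat.exists_eq_add_of_le (show N ≤ m by omega)
  have := hbound j
  have := hn₀ j (by omega)
  rw [Real.dist_eq, sub_zero]
  linarith

theorem tendsto_zero_of_contraction_le {θ : ℝ} (h0 : 0 < θ) (h1 : θ ≤ 1) {e d : ℕ → ℝ}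
    (he0 : ∀ n, 0 ≤ e n)
    (he : ∀ n : ℕ, e (n + 1) ≤ (1 - θ / (n + 2 : ℝ)) * e n + d n) (hd : Summable d) :
    Tendsto e atTop (𝓝 0) := by
  let w : ℕ → ℝ := fun n => Nat.rec (e 0) (fun n x => (1 - θ / (n + 2 : ℝ)) * x + d n) n
  have hw : Tendsto w atTop (𝓝 0) :=
    tendsto_zero_of_contraction h0 h1 (fun n => rfl) hd.hasSum.tendsto_sum_nat
  refine squeeze_zero he0 (fun n => ?_) hw
  induction n with
  | zero => exact le_rfl
  | succ n ih =>
    have hle : θ / (n + 2 : ℝ) ≤ 1 := by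
      rw [div_le_one (by positivity)]
      have : (0 : ℝ) ≤ n := by positivity
      linarith
    refine (he n).trans ?_
    have := mul_le_mul_of_nonneg_left ih (show 0 ≤ 1 - θ / (n + 2 : ℝ) by linarith)
    change _ ≤ (1 - θ / (n + 2 : ℝ)) * w n + d n
    linarith

/-- The partial sums grow by a factor at most `1 + ρ/(n+1)`, up to the additive `a`, while Bernoulli
makes `(n+1)^r` grow by at least `1 + r/(n+1)`. The surplus `K (r - ρ)` absorbs `a`. -/
theorem exists_sum_le_mul_rpow {u : ℕ → ℝ} {a ρ r : ℝ} (ha : 0 ≤ a) (hρ : 0 ≤ ρ)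
    (hρr : ρ < r) (hr : 1 ≤ r)
    (hu : ∀ n : ℕ, u (n + 1) ≤ a + ρ / (n + 1 : ℝ) * ∑ k ∈ Finset.range (n + 1), u k) :
    ∃ K : ℝ, 0 ≤ K ∧ ∀ n : ℕ, ∑ k ∈ Finset.range (n + 1), u k ≤ K * (n + 1 : ℝ) ^ r := by
  set K := |u 0| + a / (r - ρ) with hK
  have hd : 0 < r - ρ := by linarith
  have hK0 : 0 ≤ K := by positivity
  have haK : a ≤ K * (r - ρ) := by
    rw [hK, add_mul, div_mul_cancel₀ _ hd.ne']
    have : 0 ≤ |u 0| * (r - ρ) := by positivity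
    linarith
  refine ⟨K, hK0, fun n => ?_⟩
  induction n with
  | zero =>
    simp
    have : 0 ≤ a / (r - ρ) := by positivity
    linarith [le_abs_self (u 0)]
  | succ n ih =>
    rw [Finset.sum_range_succ]
    set V := ∑ k ∈ Finset.range (n + 1), u k
    have hn : (0 : ℝ) < n + 1 := by positivity
    have h2 := one_add_mul_self_le_rpow_one_add (s := 1 / (n + 1 : ℝ))
      (by have : (0 : ℝ) ≤ 1 / (n + 1) := by positivity
          linarith) hr
    have h3 : (n + 1 : ℝ) ^ r * (1 + 1 / (n + 1 : ℝ)) ^ r = ((n + 1 : ℕ) + 1 : ℝ) ^ r := by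
      rw [← Real.mul_rpow hn.le (by positivity)]; congr 1; push_cast; field_simp
    have h4 : (n + 1 : ℝ) ≤ (n + 1 : ℝ) ^ r :=
      Real.self_le_rpow_of_one_le (by have : (0 : ℝ) ≤ n := by positivity
                                      linarith) hr
    have h5 : 1 ≤ (n + 1 : ℝ) ^ r * (1 / (n + 1)) := by
      rw [mul_one_div, le_div_iff₀ hn]; linarith
    rw [← h3]
    have h6 := mul_le_mul_of_nonneg_left h2 (show 0 ≤ K * (n + 1 : ℝ) ^ r by positivity)
    have h7 := mul_le_mul_of_nonneg_left ih (show 0 ≤ 1 + ρ / (n + 1 : ℝ) by positivity)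
    have h8 := mul_le_mul_of_nonneg_left h5 (show 0 ≤ K * (r - ρ) by positivity)
    have h9 := hu n
    calc V + u (n + 1) ≤ (1 + ρ / (n + 1 : ℝ)) * V + a := by linarith
      _ ≤ (1 + ρ / (n + 1 : ℝ)) * (K * (n + 1 : ℝ) ^ r) +
          K * (r - ρ) * ((n + 1 : ℝ) ^ r * (1 / (n + 1))) := by linarith
      _ = K * (n + 1 : ℝ) ^ r * (1 + r * (1 / (n + 1))) := by ring
      _ ≤ _ := by linarith

theorem tendsto_sum_inv_div_log :
    Tendsto (fun n : ℕ => (∑ k ∈ Finset.range n, 1 / (k + 2 : ℝ)) / Real.log (n + 1))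
      atTop (𝓝 1) := by
  have hlog : Tendsto (fun n : ℕ => Real.log (n + 1 : ℝ)) atTop atTop :=
    Real.tendsto_log_atTop.comp
      (tendsto_atTop_add_const_right _ _ tendsto_natCast_atTop_atTop)
  have h1 := (((tendsto_add_atTop_iff_nat 1).2 Real.tendsto_harmonic_sub_log).sub_const 1).div_atTop
    hlog
  have h2 := h1.add_const 1
  rw [zero_add] at h2
  refine h2.congr' ?_
  filter_upwards [hlog.eventually_gt_atTop 0] with n hn
  have hs : ((harmonic (n + 1) : ℚ) : ℝ) = 1 + ∑ k ∈ Finset.range n, 1 / (k + 2 : ℝ) := by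
    rw [harmonic, Finset.sum_range_succ']
    push_cast
    rw [add_comm]
    congr 1
    · simp
    · refine Finset.sum_congr rfl fun k _ => ?_
      rw [one_div]; congr 1; ring
  rw [hs]
  push_cast
  field_simp
  ring

/-! ### Moments of order `γ` and martingale convergence -/

theorem abs_add_rpow_le_four_mul {γ : ℝ} (h1 : 1 ≤ γ) (h2 : γ ≤ 2) (a b : ℝ) :
    |a + b| ^ γ ≤ 4 * (|a| ^ γ + |b| ^ γ) := by
  have h := (convexOn_rpow h1).2 (abs_nonneg a) (abs_nonneg b) (by norm_num : (0 : ℝ) ≤ 1 / 2)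
    (by norm_num : (0 : ℝ) ≤ 1 / 2) (by norm_num)
  have h3 : |a + b| ^ γ ≤ (2 * ((1 / 2 : ℝ) • |a| + (1 / 2 : ℝ) • |b|)) ^ γ := by
    apply Real.rpow_le_rpow (abs_nonneg _) _ (by linarith)
    simp only [smul_eq_mul]
    linarith [abs_add_le a b]
  rw [Real.mul_rpow (by norm_num) (by positivity)] at h3
  have h4 : (2 : ℝ) ^ γ ≤ 2 ^ (2 : ℝ) := Real.rpow_le_rpow_of_exponent_le (by norm_num) h2
  norm_num at h4
  simp only [smul_eq_mul] at h h3
  have ha : 0 ≤ |a| ^ γ := by positivity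
  have hb : 0 ≤ |b| ^ γ := by positivity
  have h5 : 0 ≤ (1 / 2 * |a| + 1 / 2 * |b|) ^ γ := by positivity
  nlinarith

section Moments

variable {Ω : Type*} {m0 : MeasurableSpace Ω} {μ : Measure Ω} {γ : ℝ}

theorem MeasureTheory.MemLp.integrable_abs_rpow {f : Ω → ℝ} (hγ : 0 < γ)
    (hf : MemLp f (ENNReal.ofReal γ) μ) : Integrable (fun ω => |f ω| ^ γ) μ := by
  have := hf.integrable_norm_rpow (by simpa using hγ) ENNReal.ofReal_ne_top
  simpa [ENNReal.toReal_ofReal hγ.le] using this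

theorem MeasureTheory.MemLp.eLpNorm_eq_ofReal_integral_abs_rpow {f : Ω → ℝ} (hγ : 0 < γ)
    (hf : MemLp f (ENNReal.ofReal γ) μ) :
    eLpNorm f (ENNReal.ofReal γ) μ = ENNReal.ofReal ((∫ ω, |f ω| ^ γ ∂μ) ^ γ⁻¹) := by
  rw [hf.eLpNorm_eq_integral_rpow_norm (by simpa using hγ) ENNReal.ofReal_ne_top]
  simp [ENNReal.toReal_ofReal hγ.le]

theorem tendsto_eLpNorm_of_tendsto_integral_abs_rpow {f : ℕ → Ω → ℝ} (hγ : 0 < γ)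
    (hf : ∀ n, MemLp (f n) (ENNReal.ofReal γ) μ)
    (h : Tendsto (fun n => ∫ ω, |f n ω| ^ γ ∂μ) atTop (𝓝 0)) :
    Tendsto (fun n => eLpNorm (f n) (ENNReal.ofReal γ) μ) atTop (𝓝 0) := by
  simp_rw [fun n => (hf n).eLpNorm_eq_ofReal_integral_abs_rpow hγ]
  have h' := h.rpow_const (p := γ⁻¹) (Or.inr (by positivity))
  rw [Real.zero_rpow (by positivity)] at h'
  simpa using ENNReal.tendsto_ofReal h'

theorem integral_abs_add_rpow_le_four_mul {f g : Ω → ℝ} (h1 : 1 ≤ γ) (h2 : γ ≤ 2)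
    (hf : MemLp f (ENNReal.ofReal γ) μ) (hg : MemLp g (ENNReal.ofReal γ) μ) :
    ∫ ω, |f ω + g ω| ^ γ ∂μ ≤ 4 * (∫ ω, |f ω| ^ γ ∂μ + ∫ ω, |g ω| ^ γ ∂μ) := by
  have hγ : 0 < γ := by linarith
  rw [← integral_add (hf.integrable_abs_rpow hγ) (hg.integrable_abs_rpow hγ), ← integral_const_mul]
  exact integral_mono ((hf.add hg).integrable_abs_rpow hγ)
    (((hf.integrable_abs_rpow hγ).add (hg.integrable_abs_rpow hγ)).const_mul _)
    fun ω => abs_add_rpow_le_four_mul h1 h2 _ _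

theorem integral_abs_const_mul_rpow (c : ℝ) (f : Ω → ℝ) :
    ∫ ω, |c * f ω| ^ γ ∂μ = |c| ^ γ * ∫ ω, |f ω| ^ γ ∂μ := by
  rw [← integral_const_mul]
  congr with ω
  rw [abs_mul, Real.mul_rpow (abs_nonneg _) (abs_nonneg _)]

variable [IsProbabilityMeasure μ]

/-- A version of the von Bahr–Esseen inequality for one conditionally centred increment. -/
theorem integral_abs_add_rpow_le_of_condExp_eq_zero {m : MeasurableSpace Ω} (hm : m ≤ m0)
    (h1 : 1 ≤ γ) (h2 : γ ≤ 2) {A D : Ω → ℝ} (hAm : StronglyMeasurable[m] A)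
    (hA : MemLp A (ENNReal.ofReal γ) μ) (hD : MemLp D (ENNReal.ofReal γ) μ)
    (h0 : μ[D | m] =ᵐ[μ] 0) :
    ∫ ω, |A ω + D ω| ^ γ ∂μ ≤ ∫ ω, |A ω| ^ γ ∂μ + 4 * ∫ ω, |D ω| ^ γ ∂μ := by
  have hγ : 0 < γ := by linarith
  have iA := hA.integrable_abs_rpow hγ
  have iD := hD.integrable_abs_rpow hγ
  have hDint : Integrable D μ := hD.integrable (by simpa using h1)
  -- Up to the factor `γ`, the derivative of `|·|^γ` at `A`. It is `m`-measurable, so it can be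
  -- pulled out of the conditional expectation and `φ * D` has mean 0.
  let φ : Ω → ℝ := fun ω => |A ω| ^ γ / A ω
  have hφm : StronglyMeasurable[m] φ := by
    have := hAm.measurable
    exact (Measurable.div ((continuous_abs.measurable.comp this).pow_const γ) this).stronglyMeasurable
  have hφD : Integrable (φ * D) μ := by
    refine (iA.add iD).mono' ((hφm.mono hm).aestronglyMeasurable.mul hD.1) (ae_of_all _ fun ω => ?_)
    exact abs_rpow_div_mul_le h1 _ _
  have hφ0 : ∫ ω, (φ * D) ω ∂μ = 0 := by
    rw [← integral_condExp hm]
    have : μ[φ * D | m] =ᵐ[μ] 0 := by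
      filter_upwards [condExp_mul_of_stronglyMeasurable_left hφm hφD hDint, h0] with ω e1 e2
      rw [e1, Pi.mul_apply, e2]; simp
    rw [integral_congr_ae this]; simp
  calc ∫ ω, |A ω + D ω| ^ γ ∂μ
      ≤ ∫ ω, (|A ω| ^ γ + γ * (φ * D) ω + 4 * |D ω| ^ γ) ∂μ :=
        integral_mono ((hA.add hD).integrable_abs_rpow hγ)
          ((iA.add (hφD.const_mul γ)).add (iD.const_mul 4)) fun ω => abs_add_rpow_le h1 h2 _ _
    _ = ∫ ω, (|A ω| ^ γ + γ * (φ * D) ω) ∂μ + ∫ ω, 4 * |D ω| ^ γ ∂μ :=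
        integral_add (iA.add (hφD.const_mul γ)) (iD.const_mul 4)
    _ = _ := by
        rw [integral_add iA (hφD.const_mul γ), integral_const_mul, hφ0, integral_const_mul]
        ring

theorem tendsto_eLpNorm_const_add_inv_mul {f : ℕ → Ω → ℝ} {b l : ℕ → ℝ} {B : ℝ} (h1 : 1 ≤ γ)
    (h2 : γ ≤ 2) (hb : Tendsto b atTop (𝓝 0)) (hl : Tendsto l atTop atTop)
    (hf : ∀ n, MemLp (f n) (ENNReal.ofReal γ) μ) (hB : ∀ n, ∫ ω, |f n ω| ^ γ ∂μ ≤ B) :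
    Tendsto (fun n => eLpNorm (fun ω => b n + (l n)⁻¹ * f n ω) (ENNReal.ofReal γ) μ) atTop
      (𝓝 0) := by
  have hγ : 0 < γ := by linarith
  refine tendsto_eLpNorm_of_tendsto_integral_abs_rpow hγ
    (fun n => (memLp_const (b n)).add ((hf n).const_mul _)) ?_
  have hlim : Tendsto (fun n => 4 * (|b n| ^ γ + |(l n)⁻¹| ^ γ * B)) atTop (𝓝 0) := by
    have h1 := hb.abs.rpow_const (p := γ) (Or.inr hγ.le)
    have h2 := ((tendsto_inv_atTop_zero.comp hl).abs.rpow_const (p := γ)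
      (Or.inr hγ.le)).mul_const B
    have := (h1.add h2).const_mul 4
    simpa [Real.zero_rpow hγ.ne'] using this
  refine squeeze_zero (fun n => integral_nonneg fun ω => by positivity) (fun n => ?_) hlim
  refine (integral_abs_add_rpow_le_four_mul h1 h2 (memLp_const (b n))
    ((hf n).const_mul _)).trans ?_
  rw [integral_abs_const_mul_rpow]
  have := mul_le_mul_of_nonneg_left (hB n) (show 0 ≤ |(l n)⁻¹| ^ γ by positivity)
  simp only [integral_const, probReal_univ, one_smul]
  linarith

section Increments

variable {𝓕 : Filtration ℕ m0} {D : ℕ → Ω → ℝ}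

theorem integral_abs_sum_rpow_le (h1 : 1 ≤ γ) (h2 : γ ≤ 2)
    (hDm : ∀ n, StronglyMeasurable[𝓕 (n + 1)] (D n))
    (hD : ∀ n, MemLp (D n) (ENNReal.ofReal γ) μ) (h0 : ∀ n, μ[D n | 𝓕 n] =ᵐ[μ] 0)
    (hs : Summable fun n => ∫ ω, |D n ω| ^ γ ∂μ) (n : ℕ) :
    ∫ ω, |∑ k ∈ Finset.range n, D k ω| ^ γ ∂μ ≤ 4 * ∑' n, ∫ ω, |D n ω| ^ γ ∂μ := by
  have hle : ∫ ω, |∑ k ∈ Finset.range n, D k ω| ^ γ ∂μ ≤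
      4 * ∑ k ∈ Finset.range n, ∫ ω, |D k ω| ^ γ ∂μ := by
    induction n with
    | zero => simp [Real.zero_rpow (show γ ≠ 0 by linarith)]
    | succ n ih =>
      simp_rw [Finset.sum_range_succ]
      have := integral_abs_add_rpow_le_of_condExp_eq_zero (𝓕.le n) h1 h2
        (A := fun ω => ∑ k ∈ Finset.range n, D k ω)
        (Finset.stronglyMeasurable_fun_sum _ fun k hk =>
          (hDm k).mono (𝓕.mono (Finset.mem_range.1 hk)))
        (memLp_finsetSum _ fun k _ => hD k) (hD n) (h0 n)
      linarith
  refine hle.trans (mul_le_mul_of_nonneg_left ?_ (by norm_num))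
  exact hs.sum_le_tsum _ fun k _ => integral_nonneg fun ω => by positivity

theorem ae_exists_tendsto_sum (h1 : 1 ≤ γ) (h2 : γ ≤ 2)
    (hDm : ∀ n, StronglyMeasurable[𝓕 (n + 1)] (D n))
    (hD : ∀ n, MemLp (D n) (ENNReal.ofReal γ) μ) (h0 : ∀ n, μ[D n | 𝓕 n] =ᵐ[μ] 0)
    (hs : Summable fun n => ∫ ω, |D n ω| ^ γ ∂μ) :
    ∀ᵐ ω ∂μ, ∃ l, Tendsto (fun n => ∑ k ∈ Finset.range n, D k ω) atTop (𝓝 l) := by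
  have hγ : 0 < γ := by linarith
  have hMp (n : ℕ) : MemLp (fun ω => ∑ k ∈ Finset.range n, D k ω) (ENNReal.ofReal γ) μ :=
    memLp_finsetSum _ fun k _ => hD k
  have h1' : 1 ≤ ENNReal.ofReal γ := by simpa using h1
  have hmart : Martingale (fun n ω => ∑ k ∈ Finset.range n, D k ω) 𝓕 μ := by
    refine martingale_of_condExp_sub_eq_zero_nat
      (fun n => Finset.stronglyMeasurable_fun_sum _ fun k hk =>
          (hDm k).mono (𝓕.mono (Finset.mem_range.1 hk))) (fun n => (hMp n).integrable h1')
      fun n => ?_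
    have : ((fun ω => ∑ k ∈ Finset.range (n + 1), D k ω) - fun ω => ∑ k ∈ Finset.range n, D k ω)
        = D n := by
      ext ω; simp [Finset.sum_range_succ]
    rw [this]
    exact h0 n
  -- Doob's theorem needs only a bound in `L^1`, which follows from the one in `L^γ`.
  refine hmart.submartingale.exists_ae_tendsto_of_bdd
    (R := ((4 * ∑' n, ∫ ω, |D n ω| ^ γ ∂μ) ^ γ⁻¹).toNNReal) fun n => ?_
  refine (eLpNorm_le_eLpNorm_of_exponent_le h1' (hMp n).1).trans ?_
  rw [(hMp n).eLpNorm_eq_ofReal_integral_abs_rpow hγ]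
  refine ENNReal.ofReal_le_ofReal (Real.rpow_le_rpow (integral_nonneg fun ω => by positivity)
    (integral_abs_sum_rpow_le h1 h2 hDm hD h0 hs n) (by positivity))

end Increments

end Moments

/-! ### Averaging processes and their laws of large numbers -/

/-- A process `y` whose next value is, in conditional mean, affine in the average of the previous
values, and whose moments of order `γ` satisfy the corresponding recursive bound. -/
structure IsAveraging {Ω : Type*} {m0 : MeasurableSpace Ω} (μ : Measure Ω)
    (𝓕 : Filtration ℕ m0) (y : ℕ → Ω → ℝ) (γ c q a ρ : ℝ) : Prop where
  one_lt : 1 < γ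
  le_two : γ ≤ 2
  adapted : StronglyAdapted 𝓕 y
  memLp : ∀ n, MemLp (y n) (ENNReal.ofReal γ) μ
  nonneg_left : 0 ≤ a
  nonneg_right : 0 ≤ ρ
  right_lt : ρ < γ
  condExp_eq : ∀ n : ℕ, μ[y (n + 1) | 𝓕 n] =ᵐ[μ]
    fun ω => c + q / (n + 1 : ℝ) * ∑ k ∈ Finset.range (n + 1), y k ω
  moment_le : ∀ n : ℕ, ∫ ω, |y (n + 1) ω| ^ γ ∂μ ≤
    a + ρ / (n + 1 : ℝ) * ∑ k ∈ Finset.range (n + 1), ∫ ω, |y k ω| ^ γ ∂μ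

namespace IsAveraging

variable {Ω : Type*} {m0 : MeasurableSpace Ω} {μ : Measure Ω}
  {𝓕 : Filtration ℕ m0} {y : ℕ → Ω → ℝ} {γ c q a ρ : ℝ}

/-- The innovation at time `n + 1`, normalised by `n + 2`. -/
noncomputable def innov (y : ℕ → Ω → ℝ) (c q : ℝ) (n : ℕ) (ω : Ω) : ℝ :=
  (n + 2 : ℝ)⁻¹ * (y (n + 1) ω - (c + q / (n + 1 : ℝ) * ∑ k ∈ Finset.range (n + 1), y k ω))

theorem one_le_exponent (h : IsAveraging μ 𝓕 y γ c q a ρ) : 1 ≤ ENNReal.ofReal γ := by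
  simpa using h.one_lt.le

theorem stronglyMeasurable_predict (h : IsAveraging μ 𝓕 y γ c q a ρ) (n : ℕ) :
    StronglyMeasurable[𝓕 n]
      (fun ω => c + q / (n + 1 : ℝ) * ∑ k ∈ Finset.range (n + 1), y k ω) :=
  stronglyMeasurable_const.add (stronglyMeasurable_const.mul
    (Finset.stronglyMeasurable_fun_sum _ fun k hk =>
      (h.adapted k).mono (𝓕.mono (Nat.lt_succ_iff.1 (Finset.mem_range.1 hk)))))

theorem memLp_sum (h : IsAveraging μ 𝓕 y γ c q a ρ) (n : ℕ) :
    MemLp (fun ω => ∑ k ∈ Finset.range n, y k ω) (ENNReal.ofReal γ) μ :=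
  memLp_finsetSum _ fun k _ => h.memLp k

theorem stronglyMeasurable_innov (h : IsAveraging μ 𝓕 y γ c q a ρ) (n : ℕ) :
    StronglyMeasurable[𝓕 (n + 1)] (innov y c q n) :=
  stronglyMeasurable_const.mul
    ((h.adapted (n + 1)).sub ((h.stronglyMeasurable_predict n).mono (𝓕.mono n.le_succ)))

variable [IsProbabilityMeasure μ]

theorem memLp_predict (h : IsAveraging μ 𝓕 y γ c q a ρ) (n : ℕ) :
    MemLp (fun ω => c + q / (n + 1 : ℝ) * ∑ k ∈ Finset.range (n + 1), y k ω)
      (ENNReal.ofReal γ) μ :=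
  (memLp_const c).add ((h.memLp_sum (n + 1)).const_mul _)

theorem memLp_innov (h : IsAveraging μ 𝓕 y γ c q a ρ) (n : ℕ) :
    MemLp (innov y c q n) (ENNReal.ofReal γ) μ :=
  ((h.memLp (n + 1)).sub (h.memLp_predict n)).const_mul _

theorem condExp_innov (h : IsAveraging μ 𝓕 y γ c q a ρ) (n : ℕ) :
    μ[innov y c q n | 𝓕 n] =ᵐ[μ] 0 := by
  set P : Ω → ℝ := fun ω => c + q / (n + 1 : ℝ) * ∑ k ∈ Finset.range (n + 1), y k ω with hP
  have hPi : Integrable P μ := (h.memLp_predict n).integrable h.one_le_exponent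
  have e : innov y c q n = (n + 2 : ℝ)⁻¹ • (y (n + 1) - P) := by
    ext ω; simp [innov, hP]
  rw [e]
  filter_upwards [condExp_smul (m := 𝓕 n) (μ := μ) (n + 2 : ℝ)⁻¹ (y (n + 1) - P),
    condExp_sub ((h.memLp (n + 1)).integrable h.one_le_exponent) hPi (𝓕 n),
    h.condExp_eq n] with ω e1 e2 e3
  rw [e1, Pi.smul_apply, e2, Pi.sub_apply, e3,
    condExp_of_stronglyMeasurable (𝓕.le n) (h.stronglyMeasurable_predict n) hPi]
  simp

theorem summable_integral_innov (h : IsAveraging μ 𝓕 y γ c q a ρ) :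
    Summable fun n => ∫ ω, |innov y c q n ω| ^ γ ∂μ := by
  have hγ : 0 < γ := by linarith [h.one_lt]
  -- This is where `ρ < γ` enters: any growth exponent `r` between `max 1 ρ` and `γ` gives the decay
  -- exponent `γ - r + 1 > 1`.
  obtain ⟨r, hr1, hr2⟩ := exists_between (max_lt h.one_lt h.right_lt)
  rw [max_lt_iff] at hr1
  obtain ⟨K, hK, hb⟩ := exists_sum_le_mul_rpow
    (u := fun n => ∫ ω, |y n ω| ^ γ ∂μ) h.nonneg_left h.nonneg_right hr1.2 hr1.1.le
    h.moment_le
  have hy (n : ℕ) : ∫ ω, |y (n + 1) ω| ^ γ ∂μ ≤ (a + ρ * K) * (n + 2 : ℝ) ^ (r - 1) := by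
    have hn : (0 : ℝ) < n + 1 := by positivity
    have h1 := mul_le_mul_of_nonneg_left (hb n) (show 0 ≤ ρ / (n + 1 : ℝ) from
      div_nonneg h.nonneg_right hn.le)
    have h2 : ρ / (n + 1 : ℝ) * (K * (n + 1 : ℝ) ^ r) = ρ * K * (n + 1 : ℝ) ^ (r - 1) := by
      rw [Real.rpow_sub_one hn.ne']; ring
    have h3 : (n + 1 : ℝ) ^ (r - 1) ≤ (n + 2 : ℝ) ^ (r - 1) :=
      Real.rpow_le_rpow hn.le (by linarith) (by linarith)
    have h4 : 1 ≤ (n + 2 : ℝ) ^ (r - 1) := Real.one_le_rpow (by linarith) (by linarith)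
    have h5 := mul_le_mul_of_nonneg_left h3 (mul_nonneg h.nonneg_right hK)
    have h6 := mul_le_mul_of_nonneg_left h4 h.nonneg_left
    linarith [h.moment_le n]
  have hD (n : ℕ) : ∫ ω, |innov y c q n ω| ^ γ ∂μ ≤
      8 * (a + ρ * K) * (1 / |(n : ℝ) + 2| ^ (γ - r + 1)) := by
    have hn : (0 : ℝ) < n + 2 := by positivity
    have e1 : ∫ ω, |innov y c q n ω| ^ γ ∂μ = |(n + 2 : ℝ)⁻¹| ^ γ *
        ∫ ω, |y (n + 1) ω + -(c + q / (n + 1 : ℝ) * ∑ k ∈ Finset.range (n + 1), y k ω)| ^ γ ∂μ := by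
      rw [← integral_abs_const_mul_rpow]; rfl
    have e2 := integral_abs_add_rpow_le_four_mul h.one_lt.le h.le_two (h.memLp (n + 1))
      (h.memLp_predict n).neg
    -- Conditional Jensen: the prediction has no larger `γ`-moment than `y (n + 1)`. This turns the
    -- 4 of the power inequality into 8.
    have e3 : ∫ ω, |(-fun ω => c + q / (n + 1 : ℝ) * ∑ k ∈ Finset.range (n + 1), y k ω) ω| ^ γ ∂μ ≤
        ∫ ω, |y (n + 1) ω| ^ γ ∂μ := by
      have := integral_norm_condExp_rpow_le (m := 𝓕 n) (μ := μ) h.one_lt.le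
        (f := y (n + 1)) ((h.memLp (n + 1)).integrable_abs_rpow hγ)
      refine le_trans (le_of_eq (integral_congr_ae ?_)) this
      filter_upwards [h.condExp_eq n] with ω hω
      rw [hω, Pi.neg_apply, abs_neg, Real.norm_eq_abs]
    have e4 : |(n + 2 : ℝ)⁻¹| ^ γ * (n + 2 : ℝ) ^ (r - 1) = 1 / |(n : ℝ) + 2| ^ (γ - r + 1) := by
      rw [abs_of_pos (by positivity), abs_of_pos hn, Real.inv_rpow hn.le, ← Real.rpow_neg hn.le,
        ← Real.rpow_add hn, one_div, ← Real.rpow_neg hn.le]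
      congr 1; ring
    rw [e1, ← e4]
    have e5 : ∫ ω, |y (n + 1) ω + -(c + q / (n + 1 : ℝ) *
        ∑ k ∈ Finset.range (n + 1), y k ω)| ^ γ ∂μ ≤ 8 * ((a + ρ * K) * (n + 2 : ℝ) ^ (r - 1)) := by
      refine e2.trans ?_
      linarith [hy n]
    have := mul_le_mul_of_nonneg_left e5 (show 0 ≤ |(n + 2 : ℝ)⁻¹| ^ γ by positivity)
    linarith
  refine Summable.of_nonneg_of_le (fun n => integral_nonneg fun ω => by positivity) hD
    (Summable.mul_left _ ?_)
  exact (Real.summable_one_div_nat_add_rpow 2 _).2 (by linarith)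

/-- Almost sure convergence of the normalised martingale. -/
theorem ae_exists_tendsto_sum_innov (h : IsAveraging μ 𝓕 y γ c q a ρ) :
    ∀ᵐ ω ∂μ, ∃ l, Tendsto (fun n => ∑ k ∈ Finset.range n, innov y c q k ω) atTop (𝓝 l) :=
  ae_exists_tendsto_sum h.one_lt.le h.le_two h.stronglyMeasurable_innov h.memLp_innov
    h.condExp_innov h.summable_integral_innov

theorem average_succ (n : ℕ) (ω : Ω) :
    (∑ k ∈ Finset.range (n + 2), y k ω) / (n + 2 : ℝ) =
      (1 - (1 - q) / (n + 2 : ℝ)) * ((∑ k ∈ Finset.range (n + 1), y k ω) / (n + 1 : ℝ)) +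
        c / (n + 2 : ℝ) + innov y c q n ω := by
  rw [Finset.sum_range_succ, innov]
  have h1 : (n + 1 : ℝ) ≠ 0 := by positivity
  have h2 : (n + 2 : ℝ) ≠ 0 := by positivity
  field_simp
  ring

/-- The law of large numbers when `q < 1`. -/
theorem tendsto_average (h : IsAveraging μ 𝓕 y γ c q a ρ) (hq0 : 0 ≤ q) (hq1 : q < 1) :
    (∀ᵐ ω ∂μ, Tendsto (fun n : ℕ => (∑ k ∈ Finset.range (n + 1), y k ω) / (n + 1 : ℝ)) atTop
      (𝓝 (c / (1 - q)))) ∧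
    Tendsto (fun n : ℕ => eLpNorm
      (fun ω => (∑ k ∈ Finset.range (n + 1), y k ω) / (n + 1 : ℝ) - c / (1 - q))
      (ENNReal.ofReal γ) μ) atTop (𝓝 0) := by
  have hγ : 0 < γ := by linarith [h.one_lt]
  have hq : 0 < 1 - q := by linarith
  let W : ℕ → Ω → ℝ := fun n ω => (∑ k ∈ Finset.range (n + 1), y k ω) / (n + 1 : ℝ) - c / (1 - q)
  have hW (n : ℕ) (ω : Ω) : W (n + 1) ω =
      (1 - (1 - q) / (n + 2 : ℝ)) * W n ω + innov y c q n ω := by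
    have h2 : (n + 2 : ℝ) ≠ 0 := by positivity
    have e := average_succ (y := y) (c := c) (q := q) n ω
    have e' : (((n + 1 : ℕ) : ℝ) + 1) = n + 2 := by push_cast; ring
    simp only [W, e']
    rw [e]
    field_simp
    ring
  have hWL (n : ℕ) : MemLp (W n) (ENNReal.ofReal γ) μ := by
    have := ((h.memLp_sum (n + 1)).const_mul (n + 1 : ℝ)⁻¹).sub (memLp_const (c / (1 - q)))
    refine this.congr_norm ?_ ?_
    · exact (this.1.congr (ae_of_all _ fun ω => by simp [W]; ring))
    · exact ae_of_all _ fun ω => by simp only [W, Pi.sub_apply]; congr 2; ring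
  constructor
  · filter_upwards [h.ae_exists_tendsto_sum_innov] with ω ⟨l, hl⟩
    have := (tendsto_zero_of_contraction (w := fun n => W n ω) hq (by linarith)
      (fun n => hW n ω) hl).add_const
      (c / (1 - q))
    simpa [W] using this
  · refine tendsto_eLpNorm_of_tendsto_integral_abs_rpow hγ hWL ?_
    refine tendsto_zero_of_contraction_le hq (by linarith)
      (fun n => integral_nonneg fun ω => by positivity) (fun n => ?_)
      (h.summable_integral_innov.mul_left 4)
    have hn : (1 - q) / (n + 2 : ℝ) ≤ 1 := by
      rw [div_le_one (by positivity)]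
      have : (0 : ℝ) ≤ n := by positivity
      linarith
    have hn' : 0 ≤ (1 - q) / (n + 2 : ℝ) := by positivity
    set b := 1 - (1 - q) / (n + 2 : ℝ) with hb
    have hb0 : 0 ≤ b := by linarith
    have hWm : StronglyMeasurable[𝓕 n] (fun ω => b * W n ω) := by
      refine stronglyMeasurable_const.mul ?_
      refine StronglyMeasurable.sub ?_ stronglyMeasurable_const
      simp only [div_eq_mul_inv]
      exact (Finset.stronglyMeasurable_fun_sum _ fun k hk =>
        (h.adapted k).mono (𝓕.mono (Nat.lt_succ_iff.1 (Finset.mem_range.1 hk)))).mul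
          stronglyMeasurable_const
    have e1 := integral_abs_add_rpow_le_of_condExp_eq_zero (𝓕.le n) h.one_lt.le h.le_two
      hWm ((hWL n).const_mul b) (h.memLp_innov n) (h.condExp_innov n)
    rw [integral_abs_const_mul_rpow] at e1
    have e0 (ω : Ω) : b * W n ω + innov y c q n ω = W (n + 1) ω := (hW n ω).symm
    simp_rw [e0] at e1
    change ∫ ω, |W (n + 1) ω| ^ γ ∂μ ≤ b * ∫ ω, |W n ω| ^ γ ∂μ + _
    -- Since `0 ≤ b ≤ 1` and `γ ≥ 1`, the `γ`-moments contract at least as fast as the averages do.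
    have e2 : |b| ^ γ ≤ b := by
      rw [abs_of_nonneg hb0]
      exact Real.rpow_le_self_of_le_one hb0 (by linarith) h.one_lt.le
    have e3 := mul_le_mul_of_nonneg_right e2
      (show 0 ≤ ∫ ω, |W n ω| ^ γ ∂μ from integral_nonneg fun ω => by positivity)
    linarith

/-- The law of large numbers in the critical case `q = 1`. -/
theorem tendsto_average_div_log (h : IsAveraging μ 𝓕 y γ c 1 a ρ) :
    (∀ᵐ ω ∂μ, Tendsto (fun n : ℕ => (∑ k ∈ Finset.range (n + 1), y k ω) /
      ((n + 1 : ℝ) * Real.log (n + 1))) atTop (𝓝 c)) ∧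
    Tendsto (fun n : ℕ => eLpNorm
      (fun ω => (∑ k ∈ Finset.range (n + 1), y k ω) / ((n + 1 : ℝ) * Real.log (n + 1)) - c)
      (ENNReal.ofReal γ) μ) atTop (𝓝 0) := by
  have hγ : 0 < γ := by linarith [h.one_lt]
  let s : ℕ → ℝ := fun n => ∑ k ∈ Finset.range n, 1 / (k + 2 : ℝ)
  let l : ℕ → ℝ := fun n => Real.log (n + 1 : ℝ)
  let M : ℕ → Ω → ℝ := fun n ω => ∑ k ∈ Finset.range n, innov y c 1 k ω
  have hR (n : ℕ) (ω : Ω) : (∑ k ∈ Finset.range (n + 1), y k ω) / (n + 1 : ℝ) =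
      c * s n + (y 0 ω + M n ω) := by
    induction n with
    | zero => simp [s, M]
    | succ n ih =>
      have e := average_succ (y := y) (c := c) (q := 1) n ω
      have e' : (((n + 1 : ℕ) : ℝ) + 1) = n + 2 := by push_cast; ring
      rw [e', e, ih]
      simp only [s, M, Finset.sum_range_succ]
      ring
  have hl : Tendsto l atTop atTop :=
    Real.tendsto_log_atTop.comp (tendsto_atTop_add_const_right _ _ tendsto_natCast_atTop_atTop)
  have hs : Tendsto (fun n => c * (s n / l n - 1)) atTop (𝓝 0) := by
    have := (tendsto_sum_inv_div_log.sub_const 1).const_mul c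
    rwa [sub_self, mul_zero] at this
  -- Also true at `n = 0`: there `log 1 = 0`, and division by it gives 0 on both sides.
  have hZ (n : ℕ) (ω : Ω) : (∑ k ∈ Finset.range (n + 1), y k ω) /
      ((n + 1 : ℝ) * Real.log (n + 1)) - c =
      c * (s n / l n - 1) + (l n)⁻¹ * (y 0 ω + M n ω) := by
    rw [← div_div, hR]; simp only [l]; ring
  have hM (n : ℕ) : MemLp (M n) (ENNReal.ofReal γ) μ :=
    memLp_finsetSum _ fun k _ => h.memLp_innov k
  have hML (n : ℕ) : MemLp (fun ω => y 0 ω + M n ω) (ENNReal.ofReal γ) μ := (h.memLp 0).add (hM n)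
  constructor
  · filter_upwards [h.ae_exists_tendsto_sum_innov] with ω ⟨L, hL⟩
    have h1 := (hL.const_add (y 0 ω)).div_atTop hl
    have h2 := (hs.add h1).add_const c
    simp only [add_zero, zero_add] at h2
    refine h2.congr fun n => ?_
    rw [eq_comm, ← sub_eq_iff_eq_add, hZ]
    simp only [M]; ring
  · simp only [hZ]
    obtain ⟨B, hB⟩ : ∃ B, ∀ n, ∫ ω, |y 0 ω + M n ω| ^ γ ∂μ ≤ B :=
      ⟨4 * (∫ ω, |y 0 ω| ^ γ ∂μ + 4 * ∑' n, ∫ ω, |innov y c 1 n ω| ^ γ ∂μ), fun n => by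
        have e1 := integral_abs_add_rpow_le_four_mul h.one_lt.le h.le_two (h.memLp 0) (hM n)
        have e2 := integral_abs_sum_rpow_le h.one_lt.le h.le_two
          h.stronglyMeasurable_innov h.memLp_innov h.condExp_innov h.summable_integral_innov n
        exact e1.trans (by linarith)⟩
    exact tendsto_eLpNorm_const_add_inv_mul h.one_lt.le h.le_two hs hl hML hB

end IsAveraging

/-! ### The moment function near 1 and the choice of exponent -/

/-- Domination uniform in `t`, for differentiating under the integral. Of the spare exponent `α -
1`, one half absorbs the logarithm and the other half absorbs `x ^ t`. -/
theorem Real.abs_mul_log_le {x α : ℝ} (hα : 1 < α) (hx : 0 ≤ x) {t : ℝ} (ht0 : 0 ≤ t)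
    (ht : t ≤ (α - 1) / 2) :
    |x * Real.log x| * (1 + x ^ t) ≤ 2 + 2 * (2 / (α - 1)) * x ^ α := by
  set s := (α - 1) / 2 with hs
  have hs0 : 0 < s := by rw [hs]; linarith
  have hxα : 0 ≤ x ^ α := by positivity
  have hsi : 2 / (α - 1) = 1 / s := by rw [hs]; field_simp
  have hc : 0 ≤ 2 * (1 / s) * x ^ α := by positivity
  rw [hsi]
  rcases eq_or_lt_of_le hx with rfl | hx0
  · simp only [zero_mul, abs_zero]; linarith
  rcases le_total x 1 with h1 | h1
  · have h2 : |x * Real.log x| ≤ 1 := by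
      rw [abs_of_nonpos (mul_nonpos_of_nonneg_of_nonpos hx (Real.log_nonpos hx h1))]
      have := Real.one_sub_inv_le_log_of_pos hx0
      have h3 := mul_le_mul_of_nonneg_left this hx
      rw [mul_sub, mul_inv_cancel₀ hx0.ne'] at h3
      linarith
    have h3 : x ^ t ≤ 1 := Real.rpow_le_one hx h1 ht0
    have h4 : |x * Real.log x| * (1 + x ^ t) ≤ 1 * 2 :=
      mul_le_mul h2 (by linarith) (by positivity) zero_le_one
    linarith
  · have hlog : 0 ≤ Real.log x := Real.log_nonneg h1
    rw [abs_of_nonneg (mul_nonneg hx hlog)]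
    have h2 : Real.log x ≤ x ^ s / s := Real.log_le_rpow_div hx hs0
    have h3 : x ^ t ≤ x ^ s := Real.rpow_le_rpow_of_exponent_le h1 ht
    have h4 : 1 ≤ x ^ s := Real.one_le_rpow h1 hs0.le
    have h5 : x * (x ^ s / s) * (2 * x ^ s) = 2 * (1 / s) * x ^ α := by
      have : x ^ α = x * x ^ s * x ^ s := by
        rw [← Real.rpow_one_add' hx (by linarith), ← Real.rpow_add hx0]
        congr 1; rw [hs]; ring
      rw [this]; field_simp
    have : x * Real.log x * (1 + x ^ t) ≤ x * (x ^ s / s) * (2 * x ^ s) := by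
      apply mul_le_mul (mul_le_mul_of_nonneg_left h2 hx) (by linarith) (by positivity)
      positivity
    linarith

/-- Follows from `1 - 1/u ≤ log u ≤ u - 1` at `u = x ^ t`. -/
theorem Real.abs_rpow_sub_div_le {x t : ℝ} (hx : 0 ≤ x) (ht : 0 < t) :
    |(x ^ (1 + t) - x) / t| ≤ |x * Real.log x| * (1 + x ^ t) := by
  rcases eq_or_lt_of_le hx with rfl | hx0
  · simp [Real.zero_rpow (show 1 + t ≠ 0 by linarith)]
  have e : (x ^ (1 + t) - x) / t = x * ((x ^ t - 1) / t) := by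
    rw [Real.rpow_add hx0, Real.rpow_one]; ring
  rw [e, abs_mul, abs_mul, mul_assoc]
  refine mul_le_mul_of_nonneg_left ?_ (abs_nonneg x)
  have hpos : 0 < x ^ t := by positivity
  have h1 : t * Real.log x ≤ x ^ t - 1 := by
    rw [← Real.log_rpow hx0]; exact Real.log_le_sub_one_of_pos hpos
  have h2 : x ^ t - 1 ≤ t * Real.log x * x ^ t := by
    have := mul_le_mul_of_nonneg_right (Real.one_sub_inv_le_log_of_pos hpos) hpos.le
    rwa [Real.log_rpow hx0, sub_mul, inv_mul_cancel₀ hpos.ne', one_mul] at this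
  rw [abs_div, abs_of_pos ht, div_le_iff₀ ht, abs_le]
  have h3 := neg_abs_le (Real.log x)
  have h4 := le_abs_self (Real.log x)
  have h5 : 0 ≤ |Real.log x| * x ^ t * t := by positivity
  have h6 : 0 ≤ |Real.log x| * t := by positivity
  have h7 := mul_le_mul_of_nonneg_left h3 ht.le
  have h8 := mul_le_mul_of_nonneg_left h4 (mul_pos ht hpos).le
  constructor <;> linarith

/-- The right derivative at `1` of the moment function is the entropy-like integral
`∫ x, x * log x`. -/
theorem tendsto_moment_slope {ν : Measure ℝ} [IsProbabilityMeasure ν] (hν : ∀ᵐ x ∂ν, 0 ≤ x)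
    {α : ℝ} (hα : 1 < α) (hm : MemLp (fun x : ℝ => x) (ENNReal.ofReal α) ν) :
    Tendsto (fun t => (∫ x, |x| ^ (1 + t) ∂ν - ∫ x, x ∂ν) / t) (𝓝[>] 0)
      (𝓝 (∫ x, x * Real.log x ∂ν)) := by
  have hint : Integrable (fun x : ℝ => x) ν := hm.integrable (by simpa using hα.le)
  have hα' : Integrable (fun x : ℝ => |x| ^ α) ν := hm.integrable_abs_rpow (by linarith)
  have hev : ∀ᶠ t : ℝ in 𝓝[>] 0, 0 < t ∧ t ≤ (α - 1) / 2 := by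
    filter_upwards [self_mem_nhdsWithin,
      mem_nhdsWithin_of_mem_nhds (Iic_mem_nhds (show 0 < (α - 1) / 2 by linarith))] with t h1 h2
    exact ⟨h1, h2⟩
  have hmeas (t : ℝ) : Measurable fun x : ℝ => |x| ^ (1 + t) :=
    continuous_abs.measurable.pow_const _
  have key : Tendsto (fun t => ∫ x, (|x| ^ (1 + t) - x) / t ∂ν) (𝓝[>] 0)
      (𝓝 (∫ x, x * Real.log x ∂ν)) := by
    refine tendsto_integral_filter_of_dominated_convergence
      (fun x => 2 + 2 * (2 / (α - 1)) * |x| ^ α)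
      (Eventually.of_forall fun t => (((hmeas t).sub measurable_id).div_const t).aestronglyMeasurable)
      ?_ ((integrable_const _).add (hα'.const_mul _)) ?_
    · filter_upwards [hev] with t ht
      filter_upwards [hν] with x hx
      rw [Real.norm_eq_abs, abs_of_nonneg hx]
      exact (Real.abs_rpow_sub_div_le hx ht.1).trans (Real.abs_mul_log_le hα hx ht.1.le ht.2)
    · filter_upwards [hν] with x hx
      rw [abs_of_nonneg hx]
      rcases eq_or_lt_of_le hx with rfl | hx0
      · refine (tendsto_const_nhds (x := (0 : ℝ))).congr' ?_ |>.trans (by simp)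
        filter_upwards [hev] with t ht
        simp [Real.zero_rpow (show 1 + t ≠ 0 by linarith [ht.1])]
      · have hd : HasDerivAt (fun t : ℝ => x ^ (1 + t)) (x * Real.log x) 0 := by
          have := ((hasDerivAt_id (0 : ℝ)).const_add 1).const_rpow (a := x) hx0
          simpa [mul_comm] using this
        have := (hasDerivAt_iff_tendsto_slope.1 hd).mono_left
          (nhdsWithin_mono 0 (fun t (ht : 0 < t) => ht.ne'))
        refine this.congr fun t => ?_
        simp [slope_def_field]
  refine key.congr' ?_
  filter_upwards [hev] with t ht
  rw [integral_div, integral_sub _ hint]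
  refine (hm.mono_exponent (ENNReal.ofReal_le_ofReal ?_)).integrable_abs_rpow ?_ <;> linarith [ht.1, ht.2]

/-- An exponent `γ ∈ (1, 2]` below `α` with `p * E[ξ ^ γ] < γ`. -/
theorem exists_exponent {ν : Measure ℝ} [IsProbabilityMeasure ν] (hν : ∀ᵐ x ∂ν, 0 ≤ x)
    {α p : ℝ} (hp : 0 < p) (hα : 1 < α) (hm : MemLp (fun x : ℝ => x) (ENNReal.ofReal α) ν)
    (h : p * (∫ x, x ∂ν) < 1 ∨
      p * (∫ x, x ∂ν) = 1 ∧ (∫ x, x * Real.log x ∂ν) < ∫ x, x ∂ν) :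
    ∃ γ, 1 < γ ∧ γ ≤ 2 ∧ γ ≤ α ∧ p * ∫ x, |x| ^ γ ∂ν < γ := by
  have hlim := tendsto_moment_slope hν hα hm
  set m := ∫ x, x ∂ν
  have hsmall : ∀ᶠ t : ℝ in 𝓝[>] 0, 0 < t ∧ t ≤ 1 ∧ t ≤ α - 1 := by
    filter_upwards [self_mem_nhdsWithin, mem_nhdsWithin_of_mem_nhds (Iic_mem_nhds one_pos),
      mem_nhdsWithin_of_mem_nhds (Iic_mem_nhds (sub_pos.2 hα))] with t h1 h2 h3
    exact ⟨h1, h2, h3⟩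
  suffices ∀ᶠ t : ℝ in 𝓝[>] 0, p * ∫ x, |x| ^ (1 + t) ∂ν < 1 + t by
    obtain ⟨t, ht, h1, h2, h3⟩ := (this.and hsmall).exists
    exact ⟨1 + t, by linarith, by linarith, by linarith, ht⟩
  rcases h with h | ⟨h, hlog⟩
  · have hid : Tendsto (fun t : ℝ => t) (𝓝[>] 0) (𝓝 0) := tendsto_nhdsWithin_of_tendsto_nhds tendsto_id
    have h1 := ((hlim.mul hid).add_const m).const_mul p
    rw [mul_zero, zero_add] at h1
    filter_upwards [h1.eventually (gt_mem_nhds h), hsmall] with t h2 h3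
    rw [div_mul_cancel₀ _ h3.1.ne', sub_add_cancel] at h2
    linarith
  -- A slope below `m` gives `E ξ^(1+t) < m + t m`; multiplying by `p`, with `p m = 1`, yields `1 +
  -- t`.
  · filter_upwards [hlim.eventually (gt_mem_nhds hlog), hsmall] with t h2 h3
    rw [div_lt_iff₀ h3.1] at h2
    have := mul_lt_mul_of_pos_left h2 hp
    nlinarith

/-! ### One step of the echoed walk -/

/-- The time at which a driving variable enters. -/
def drivingTime :
    ({n : ℕ // 1 ≤ n} ⊕ {n : ℕ // 2 ≤ n} ⊕ {n : ℕ // 2 ≤ n} ⊕ {n : ℕ // 2 ≤ n}) → ℕ :=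
  Sum.elim (fun n => n) (Sum.elim (fun n => n) (Sum.elim (fun n => n) (fun n => n)))

/-- Turns the lookup at a random time into a sum over all past times with indicator weights. Each
summand is then a fresh weight times a past value, which suits conditioning. Both sides vanish for
`u` out of range. -/
theorem sum_range_mul_ite_mul (m u : ℕ) (b : ℝ) (F : ℕ → ℝ) :
    ∑ k ∈ Finset.range m, b * (if u = k + 1 then 1 else 0) * F k =
      b * (if 1 ≤ u ∧ u < m + 1 then F (u - 1) else 0) := by
  rcases u with _ | u
  · simp
  · by_cases hu : u < m
    · rw [Finset.sum_eq_single_of_mem u (Finset.mem_range.2 hu)]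
      · simp [hu]
      · intro k _ hk
        simp [hk.symm]
    · rw [Finset.sum_eq_zero]
      · simp [hu]
      · intro k hk
        have : u ≠ k := by have := Finset.mem_range.1 hk; omega
        simp [this]

theorem echoStep_add_two {Ω : Type*} (X ε ξ : ℕ → Ω → ℝ) (U : ℕ → Ω → ℕ) (n : ℕ) (ω : Ω) :
    echoStep X ε ξ U (n + 2) ω = (1 - ε (n + 2) ω) * X (n + 2) ω +
      ∑ k ∈ Finset.range (n + 1), ε (n + 2) ω * ξ (n + 2) ω *
        (if U (n + 2) ω = k + 1 then 1 else 0) * echoStep X ε ξ U (k + 1) ω := by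
  rw [sum_range_mul_ite_mul (n + 1) _ _ fun k => echoStep X ε ξ U (k + 1) ω, echoStep]
  simp only [show ¬ n + 2 ≤ 1 by omega, if_false]
  congr 2
  by_cases hu : 1 ≤ U (n + 2) ω ∧ U (n + 2) ω < n + 2
  · rw [dif_pos hu, if_pos hu, Nat.sub_add_cancel hu.1]
  · rw [dif_neg hu, if_neg hu]

theorem echoStep_one {Ω : Type*} (X ε ξ : ℕ → Ω → ℝ) (U : ℕ → Ω → ℕ) :
    echoStep X ε ξ U 1 = X 1 := by
  ext ω; rw [echoStep]; simp

/-- At most one term of the step is nonzero, so the power distributes exactly. One conditional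
computation can then serve both means and `γ`-moments. -/
theorem abs_echoStep_add_two_rpow {Ω : Type*} (X ε ξ : ℕ → Ω → ℝ) (U : ℕ → Ω → ℕ) {γ : ℝ}
    (hγ : 0 < γ) (n : ℕ) (ω : Ω) (hε : ε (n + 2) ω = 0 ∨ ε (n + 2) ω = 1) :
    |echoStep X ε ξ U (n + 2) ω| ^ γ = (1 - ε (n + 2) ω) * |X (n + 2) ω| ^ γ +
      ∑ k ∈ Finset.range (n + 1), ε (n + 2) ω * |ξ (n + 2) ω| ^ γ *
        (if U (n + 2) ω = k + 1 then 1 else 0) * |echoStep X ε ξ U (k + 1) ω| ^ γ := by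
  rw [echoStep_add_two, sum_range_mul_ite_mul (n + 1) _ _ fun k => echoStep X ε ξ U (k + 1) ω,
    sum_range_mul_ite_mul (n + 1) _ _ fun k => |echoStep X ε ξ U (k + 1) ω| ^ γ]
  rcases hε with h | h
  · simp [h]
  · rw [h]
    split_ifs
    · simp [abs_mul, Real.mul_rpow]
    · simp [Real.zero_rpow hγ.ne']

theorem echoWalk_eq_sum_range {Ω : Type*} (X ε ξ : ℕ → Ω → ℝ) (U : ℕ → Ω → ℕ) (n : ℕ)
    (ω : Ω) :
    echoWalk X ε ξ U n ω = ∑ k ∈ Finset.range n, echoStep X ε ξ U (k + 1) ω := by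
  unfold echoWalk
  induction n with
  | zero => simp
  | succ n ih => rw [Finset.sum_Icc_succ_top (by omega), ih, Finset.sum_range_succ]

namespace IsEchoInput

variable {Ω : Type*} {X ε ξ : ℕ → Ω → ℝ} {U : ℕ → Ω → ℕ}

/-- The σ-algebra of the driving variables entering at time `N`. -/
abbrev stepSigma (X ε ξ : ℕ → Ω → ℝ) (U : ℕ → Ω → ℕ) (N : ℕ) : MeasurableSpace Ω :=
  ⨆ i ∈ {i | drivingTime i = N}, MeasurableSpace.comap (drivingFamily X ε ξ U i) inferInstance

theorem measurable_stepSigma {i} {N : ℕ} (hi : drivingTime i = N) :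
    Measurable[stepSigma X ε ξ U N] (drivingFamily X ε ξ U i) :=
  measurable_iff_comap_le.2 (le_iSup₂_of_le (f := fun i (_ : i ∈ {i | drivingTime i = N}) =>
    MeasurableSpace.comap (drivingFamily X ε ξ U i) inferInstance) i hi le_rfl)

theorem measurable_ite_eq {m : MeasurableSpace Ω} {V : Ω → ℕ} (hV : Measurable[m] fun ω => (V ω : ℝ))
    (k : ℕ) : Measurable[m] fun ω => if V ω = k then (1 : ℝ) else 0 := by
  have hg : Measurable fun x : ℝ => if x = (k : ℝ) then (1 : ℝ) else 0 :=
    Measurable.ite (measurableSet_singleton _) measurable_const measurable_const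
  simpa [Function.comp_def] using hg.comp hV

variable [m0 : MeasurableSpace Ω] {μ : Measure Ω} {p : ℝ} {νX νξ : Measure ℝ}

theorem measurable_drivingFamily (h : IsEchoInput μ p νX νξ X ε ξ U) (i) :
    Measurable (drivingFamily X ε ξ U i) := by
  rcases i with i | i | i | i
  · exact h.measurable_spin i i.2
  · exact h.measurable_bern i i.2
  · exact (measurable_from_top (f := fun n : ℕ => (n : ℝ))).comp (h.measurable_unif i i.2)
  · exact h.measurable_echo i i.2

/-- The filtration generated by the driving variables; its index is shifted so that the first
`n + 1` increments are known at time `n`. -/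
def filtration (h : IsEchoInput μ p νX νξ X ε ξ U) : Filtration ℕ m0 where
  seq n := ⨆ i ∈ {i | drivingTime i ≤ n + 1},
    MeasurableSpace.comap (drivingFamily X ε ξ U i) inferInstance
  mono' _ _ hmn := biSup_mono fun _ hi => le_trans hi (Nat.succ_le_succ hmn)
  le' _ := iSup₂_le fun i _ => (h.measurable_drivingFamily i).comap_le

theorem measurable_filtration (h : IsEchoInput μ p νX νξ X ε ξ U) {i} {n : ℕ}
    (hi : drivingTime i ≤ n + 1) : Measurable[h.filtration n] (drivingFamily X ε ξ U i) :=
  measurable_iff_comap_le.2 (le_iSup₂_of_le (f := fun i (_ : i ∈ {i | drivingTime i ≤ n + 1}) =>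
    MeasurableSpace.comap (drivingFamily X ε ξ U i) inferInstance) i hi le_rfl)

theorem stepSigma_le (h : IsEchoInput μ p νX νξ X ε ξ U) (N : ℕ) : stepSigma X ε ξ U N ≤ m0 :=
  iSup₂_le fun i _ => (h.measurable_drivingFamily i).comap_le

/-- The two σ-algebras are generated by disjoint sets of driving variables: entry time `n + 2`
against entry times at most `n + 1`. -/
theorem indep_stepSigma (h : IsEchoInput μ p νX νξ X ε ξ U) (n : ℕ) :
    Indep (stepSigma X ε ξ U (n + 2)) (h.filtration n) μ := by
  refine indep_iSup_of_disjoint (fun i => (h.measurable_drivingFamily i).comap_le) h.indep ?_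
  rw [Set.disjoint_left]
  intro i hi hi'
  simp only [Set.mem_ofPred_eq] at hi hi'
  omega

theorem stronglyAdapted_echoStep (h : IsEchoInput μ p νX νξ X ε ξ U) :
    StronglyAdapted h.filtration fun n => echoStep X ε ξ U (n + 1) := by
  intro n
  induction n using Nat.strong_induction_on with
  | _ n ih =>
    refine Measurable.stronglyMeasurable ?_
    rcases n with _ | n
    · have := h.measurable_filtration (n := 0) (i := .inl ⟨1, le_rfl⟩) le_rfl
      simp only [zero_add, echoStep_one]
      exact this
    · have hX := h.measurable_filtration (n := n + 1) (i := .inl ⟨n + 2, by omega⟩) le_rfl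
      have hε := h.measurable_filtration (n := n + 1) (i := .inr (.inl ⟨n + 2, by omega⟩)) le_rfl
      have hU := h.measurable_filtration (n := n + 1)
        (i := .inr (.inr (.inl ⟨n + 2, by omega⟩))) le_rfl
      have hξ := h.measurable_filtration (n := n + 1)
        (i := .inr (.inr (.inr ⟨n + 2, by omega⟩))) le_rfl
      change Measurable[h.filtration (n + 1)] (X (n + 2)) at hX
      change Measurable[h.filtration (n + 1)] (ε (n + 2)) at hε
      change Measurable[h.filtration (n + 1)] (ξ (n + 2)) at hξ
      change Measurable[h.filtration (n + 1)] (fun ω => (U (n + 2) ω : ℝ)) at hU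
      have e : echoStep X ε ξ U (n + 1 + 1) = _ := funext fun ω => echoStep_add_two X ε ξ U n ω
      simp only [e]
      refine ((measurable_const.sub hε).mul hX).add (Finset.measurable_fun_sum _ fun k hk => ?_)
      have hk' := Finset.mem_range.1 hk
      exact ((hε.mul hξ).mul (measurable_ite_eq hU (k + 1))).mul
        ((ih k hk').measurable.mono (h.filtration.mono hk'.le) le_rfl)

theorem ae_bern (h : IsEchoInput μ p νX νξ X ε ξ U) [IsProbabilityMeasure μ] (hp0 : 0 ≤ p)
    (hp1 : p ≤ 1) {N : ℕ} (hN : 2 ≤ N) : ∀ᵐ ω ∂μ, ε N ω = 0 ∨ ε N ω = 1 := by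
  have hm := h.measurable_bern N hN
  have m0 : MeasurableSet {ω | ε N ω = 0} := hm (measurableSet_singleton 0)
  have m1 : MeasurableSet {ω | ε N ω = 1} := hm (measurableSet_singleton 1)
  have hd : Disjoint {ω | ε N ω = 0} {ω | ε N ω = 1} := by
    rw [Set.disjoint_left]; intro ω h0 h1
    simp only [Set.mem_ofPred_eq] at h0 h1
    rw [h0] at h1; norm_num at h1
  have hu : μ ({ω | ε N ω = 0} ∪ {ω | ε N ω = 1}) = 1 := by
    rw [measure_union hd m1, h.law_bern_one N hN, h.law_bern_zero N hN,
      ← ENNReal.ofReal_add (by linarith) hp0]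
    simp
  exact (prob_compl_eq_zero_iff (m0.union m1)).2 hu

theorem integrable_bern (h : IsEchoInput μ p νX νξ X ε ξ U) [IsProbabilityMeasure μ] (hp0 : 0 ≤ p)
    (hp1 : p ≤ 1) {N : ℕ} (hN : 2 ≤ N) : Integrable (ε N) μ := by
  refine Integrable.of_bound (h.measurable_bern N hN).aestronglyMeasurable 1 ?_
  filter_upwards [h.ae_bern hp0 hp1 hN] with ω hω
  rcases hω with e | e <;> simp [e]

theorem integral_bern (h : IsEchoInput μ p νX νξ X ε ξ U) [IsProbabilityMeasure μ] (hp0 : 0 ≤ p)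
    (hp1 : p ≤ 1) {N : ℕ} (hN : 2 ≤ N) : ∫ ω, ε N ω ∂μ = p := by
  have m1 : MeasurableSet {ω | ε N ω = 1} := h.measurable_bern N hN (measurableSet_singleton 1)
  have : ε N =ᵐ[μ] {ω | ε N ω = 1}.indicator 1 := by
    filter_upwards [h.ae_bern hp0 hp1 hN] with ω hω
    rcases hω with e | e <;> simp [Set.indicator, e]
  rw [integral_congr_ae this, integral_indicator_one m1, measureReal_def, h.law_bern_one N hN,
    ENNReal.toReal_ofReal hp0]

theorem integrable_ite_unif (h : IsEchoInput μ p νX νξ X ε ξ U) [IsProbabilityMeasure μ]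
    {N : ℕ} (hN : 2 ≤ N) (k : ℕ) : Integrable (fun ω => if U N ω = k then (1 : ℝ) else 0) μ := by
  refine Integrable.of_bound (measurable_ite_eq (m := m0)
    (h.measurable_drivingFamily (.inr (.inr (.inl ⟨N, hN⟩)))) k).aestronglyMeasurable 1
    (ae_of_all _ fun ω => ?_)
  split_ifs <;> simp

theorem integral_ite_unif (h : IsEchoInput μ p νX νξ X ε ξ U) [IsProbabilityMeasure μ]
    {n k : ℕ} (hk : k < n + 1) :
    ∫ ω, (if U (n + 2) ω = k + 1 then (1 : ℝ) else 0) ∂μ = 1 / (n + 1 : ℝ) := by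
  have m1 : MeasurableSet {ω | U (n + 2) ω = k + 1} :=
    h.measurable_unif (n + 2) (by omega) (measurableSet_singleton (k + 1))
  have : (fun ω => if U (n + 2) ω = k + 1 then (1 : ℝ) else 0) =
      {ω | U (n + 2) ω = k + 1}.indicator 1 := by
    ext ω; simp [Set.indicator]
  rw [this, integral_indicator_one m1, measureReal_def,
    h.law_unif (n + 2) (by omega) (k + 1) (by omega) (by omega)]
  simp only [Nat.add_succ_sub_one, ENNReal.toReal_inv, ENNReal.toReal_natCast, one_div]
  push_cast; rfl

theorem indepFun_prodMk_unif (h : IsEchoInput μ p νX νξ X ε ξ U) {N : ℕ} (hN : 2 ≤ N) :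
    IndepFun (fun ω => (ε N ω, ξ N ω)) (fun ω => (U N ω : ℝ)) μ :=
  h.indep.indepFun_prodMk h.measurable_drivingFamily (.inr (.inl ⟨N, hN⟩))
    (.inr (.inr (.inr ⟨N, hN⟩))) (.inr (.inr (.inl ⟨N, hN⟩))) (by simp) (by simp)

theorem indepFun_bern_echo (h : IsEchoInput μ p νX νξ X ε ξ U) {N : ℕ} (hN : 2 ≤ N) :
    IndepFun (ε N) (ξ N) μ :=
  h.indep.indepFun (i := .inr (.inl ⟨N, hN⟩)) (j := .inr (.inr (.inr ⟨N, hN⟩))) (by simp)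

theorem indepFun_bern_spin (h : IsEchoInput μ p νX νξ X ε ξ U) {N : ℕ} (hN : 2 ≤ N) :
    IndepFun (ε N) (X N) μ :=
  h.indep.indepFun (i := .inr (.inl ⟨N, hN⟩)) (j := .inl ⟨N, by omega⟩) (by simp)

section OneStep

variable {φ ψ : ℝ → ℝ}

theorem integrable_comp_spin (h : IsEchoInput μ p νX νξ X ε ξ U) (hφ : Measurable φ)
    (hφi : Integrable φ νX) {N : ℕ} (hN : 1 ≤ N) : Integrable (fun ω => φ (X N ω)) μ := by
  rw [← h.law_spin N hN] at hφi
  exact (integrable_map_measure hφ.aestronglyMeasurable (h.measurable_spin N hN).aemeasurable).1 hφi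

theorem integrable_comp_echo (h : IsEchoInput μ p νX νξ X ε ξ U) (hψ : Measurable ψ)
    (hψi : Integrable ψ νξ) {N : ℕ} (hN : 2 ≤ N) : Integrable (fun ω => ψ (ξ N ω)) μ := by
  rw [← h.law_echo N hN] at hψi
  exact (integrable_map_measure hψ.aestronglyMeasurable (h.measurable_echo N hN).aemeasurable).1 hψi

theorem integral_comp_spin (h : IsEchoInput μ p νX νξ X ε ξ U) (hφ : Measurable φ)
    {N : ℕ} (hN : 1 ≤ N) : ∫ ω, φ (X N ω) ∂μ = ∫ x, φ x ∂νX := by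
  rw [← h.law_spin N hN, integral_map (h.measurable_spin N hN).aemeasurable hφ.aestronglyMeasurable]

theorem integral_comp_echo (h : IsEchoInput μ p νX νξ X ε ξ U) (hψ : Measurable ψ)
    {N : ℕ} (hN : 2 ≤ N) : ∫ ω, ψ (ξ N ω) ∂μ = ∫ x, ψ x ∂νξ := by
  rw [← h.law_echo N hN, integral_map (h.measurable_echo N hN).aemeasurable hψ.aestronglyMeasurable]

/-- The fresh term of one step. -/
theorem integrable_and_integral_fresh (h : IsEchoInput μ p νX νξ X ε ξ U) [IsProbabilityMeasure μ]
    (hp0 : 0 ≤ p) (hp1 : p ≤ 1) (hφ : Measurable φ) (hφi : Integrable φ νX) {N : ℕ} (hN : 2 ≤ N) :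
    Integrable (fun ω => (1 - ε N ω) * φ (X N ω)) μ ∧
      ∫ ω, (1 - ε N ω) * φ (X N ω) ∂μ = (1 - p) * ∫ x, φ x ∂νX := by
  have hind : IndepFun (fun ω => 1 - ε N ω) (fun ω => φ (X N ω)) μ :=
    (h.indepFun_bern_spin hN).comp (measurable_const.sub measurable_id) hφ
  have hi1 : Integrable (fun ω => 1 - ε N ω) μ :=
    (integrable_const 1).sub (h.integrable_bern hp0 hp1 hN)
  have hi2 := h.integrable_comp_spin hφ hφi (N := N) (by omega)
  refine ⟨hind.integrable_mul hi1 hi2, ?_⟩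
  rw [hind.integral_fun_mul_eq_mul_integral hi1.1 hi2.1, h.integral_comp_spin hφ (by omega),
    integral_sub (integrable_const 1) (h.integrable_bern hp0 hp1 hN), h.integral_bern hp0 hp1 hN]
  simp

/-- The weight given at one step to the increment of time `k + 1`. -/
theorem integrable_and_integral_weight (h : IsEchoInput μ p νX νξ X ε ξ U) [IsProbabilityMeasure μ]
    (hp0 : 0 ≤ p) (hp1 : p ≤ 1) (hψ : Measurable ψ) (hψi : Integrable ψ νξ) {n k : ℕ}
    (hk : k < n + 1) :
    Integrable (fun ω => ε (n + 2) ω * ψ (ξ (n + 2) ω) *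
      (if U (n + 2) ω = k + 1 then 1 else 0)) μ ∧
      ∫ ω, ε (n + 2) ω * ψ (ξ (n + 2) ω) * (if U (n + 2) ω = k + 1 then 1 else 0) ∂μ =
        p * (∫ x, ψ x ∂νξ) / (n + 1 : ℝ) := by
  have hN : 2 ≤ n + 2 := by omega
  have hg : Measurable fun x : ℝ => if x = ((k + 1 : ℕ) : ℝ) then (1 : ℝ) else 0 :=
    Measurable.ite (measurableSet_singleton _) measurable_const measurable_const
  have hind : IndepFun (fun ω => ε (n + 2) ω * ψ (ξ (n + 2) ω))
      (fun ω => if U (n + 2) ω = k + 1 then (1 : ℝ) else 0) μ := by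
    have := (h.indepFun_prodMk_unif hN).comp
      (φ := fun z : ℝ × ℝ => z.1 * ψ z.2) (measurable_fst.mul (hψ.comp measurable_snd)) hg
    simpa only [Function.comp_def, Nat.cast_inj] using this
  have hind' : IndepFun (ε (n + 2)) (fun ω => ψ (ξ (n + 2) ω)) μ :=
    (h.indepFun_bern_echo hN).comp measurable_id hψ
  have hi1 := h.integrable_bern hp0 hp1 hN
  have hi2 := h.integrable_comp_echo hψ hψi hN
  have hi3 : Integrable (fun ω => ε (n + 2) ω * ψ (ξ (n + 2) ω)) μ := hind'.integrable_mul hi1 hi2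
  have hi4 := h.integrable_ite_unif hN (k + 1)
  refine ⟨hind.integrable_mul hi3 hi4, ?_⟩
  rw [hind.integral_fun_mul_eq_mul_integral hi3.1 hi4.1,
    hind'.integral_fun_mul_eq_mul_integral hi1.1 hi2.1, h.integral_bern hp0 hp1 hN,
    h.integral_comp_echo hψ hN, h.integral_ite_unif hk]
  ring

/-- Conditional expectation of a generic one-step functional. -/
theorem integrable_and_condExp_step (h : IsEchoInput μ p νX νξ X ε ξ U) [IsProbabilityMeasure μ]
    (hp0 : 0 ≤ p) (hp1 : p ≤ 1) (hφ : Measurable φ) (hφi : Integrable φ νX) (hψ : Measurable ψ)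
    (hψi : Integrable ψ νξ) (n : ℕ) {Y : ℕ → Ω → ℝ}
    (hYm : ∀ k < n + 1, StronglyMeasurable[h.filtration n] (Y k))
    (hYi : ∀ k < n + 1, Integrable (Y k) μ) :
    Integrable (fun ω => (1 - ε (n + 2) ω) * φ (X (n + 2) ω) + ∑ k ∈ Finset.range (n + 1),
      ε (n + 2) ω * ψ (ξ (n + 2) ω) * (if U (n + 2) ω = k + 1 then 1 else 0) * Y k ω) μ ∧
    μ[fun ω => (1 - ε (n + 2) ω) * φ (X (n + 2) ω) + ∑ k ∈ Finset.range (n + 1),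
      ε (n + 2) ω * ψ (ξ (n + 2) ω) * (if U (n + 2) ω = k + 1 then 1 else 0) * Y k ω
      | h.filtration n] =ᵐ[μ] fun ω => (1 - p) * (∫ x, φ x ∂νX) +
        p * (∫ x, ψ x ∂νξ) / (n + 1 : ℝ) * ∑ k ∈ Finset.range (n + 1), Y k ω := by
  have hN : 2 ≤ n + 2 := by omega
  have hX : Measurable[stepSigma X ε ξ U (n + 2)] (X (n + 2)) :=
    measurable_stepSigma (i := .inl ⟨n + 2, by omega⟩) rfl
  have hε : Measurable[stepSigma X ε ξ U (n + 2)] (ε (n + 2)) :=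
    measurable_stepSigma (i := .inr (.inl ⟨n + 2, by omega⟩)) rfl
  have hU : Measurable[stepSigma X ε ξ U (n + 2)] (fun ω => (U (n + 2) ω : ℝ)) :=
    measurable_stepSigma (i := .inr (.inr (.inl ⟨n + 2, by omega⟩))) rfl
  have hξ : Measurable[stepSigma X ε ξ U (n + 2)] (ξ (n + 2)) :=
    measurable_stepSigma (i := .inr (.inr (.inr ⟨n + 2, by omega⟩))) rfl
  obtain ⟨hAi, hAe⟩ := h.integrable_and_integral_fresh hp0 hp1 hφ hφi hN
  have hAm : StronglyMeasurable[stepSigma X ε ξ U (n + 2)]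
      (fun ω => (1 - ε (n + 2) ω) * φ (X (n + 2) ω)) :=
    ((measurable_const.sub hε).mul (hφ.comp hX)).stronglyMeasurable
  set g : ℕ → Ω → ℝ := fun k ω => ε (n + 2) ω * ψ (ξ (n + 2) ω) *
    (if U (n + 2) ω = k + 1 then 1 else 0) with hg
  have hgm (k : ℕ) : StronglyMeasurable[stepSigma X ε ξ U (n + 2)] (g k) :=
    ((hε.mul (hψ.comp hξ)).mul (measurable_ite_eq hU (k + 1))).stronglyMeasurable
  have hgi (k : ℕ) (hk : k < n + 1) := h.integrable_and_integral_weight hp0 hp1 hψ hψi hk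
  have hind := h.indep_stepSigma n
  have hprod (k : ℕ) (hk : k < n + 1) : Integrable (fun ω => g k ω * Y k ω) μ := by
    have : IndepFun (g k) (Y k) μ := by
      rw [IndepFun_iff_Indep]
      exact indep_of_indep_of_le_left (indep_of_indep_of_le_right hind
        (hYm k hk).measurable.comap_le) (hgm k).measurable.comap_le
    exact this.integrable_mul (hgi k hk).1 (hYi k hk)
  have hsum : Integrable (fun ω => ∑ k ∈ Finset.range (n + 1), g k ω * Y k ω) μ :=
    integrable_finsetSum _ fun k hk => hprod k (Finset.mem_range.1 hk)
  refine ⟨hAi.add hsum, ?_⟩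
  -- The past value is pulled out, and the fresh weight, independent of the past, is replaced by its
  -- mean.
  have hcond (k : ℕ) (hk : k < n + 1) : μ[fun ω => g k ω * Y k ω | h.filtration n] =ᵐ[μ]
      fun ω => p * (∫ x, ψ x ∂νξ) / (n + 1 : ℝ) * Y k ω := by
    filter_upwards [condExp_mul_of_stronglyMeasurable_right (hYm k hk) (hprod k hk) (hgi k hk).1,
      condExp_indep_eq (h.stepSigma_le (n + 2)) (h.filtration.le n) (hgm k) hind] with ω e1 e2
    have e3 : μ[fun ω => g k ω * Y k ω | h.filtration n] ω = _ := e1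
    rw [e3, Pi.mul_apply, e2, (hgi k hk).2]
  have hcond' : ∀ᵐ ω ∂μ, ∀ k ∈ Finset.range (n + 1), μ[fun ω => g k ω * Y k ω | h.filtration n] ω =
      p * (∫ x, ψ x ∂νξ) / (n + 1 : ℝ) * Y k ω :=
    (Finset.eventually_all _).2 fun k hk => hcond k (Finset.mem_range.1 hk)
  have esum : (fun ω => ∑ k ∈ Finset.range (n + 1), g k ω * Y k ω) =
      ∑ k ∈ Finset.range (n + 1), fun ω => g k ω * Y k ω := by
    ext ω; simp
  filter_upwards [condExp_add hAi hsum (h.filtration n),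
    condExp_indep_eq (h.stepSigma_le (n + 2)) (h.filtration.le n) hAm hind, hcond',
    condExp_finsetSum (s := Finset.range (n + 1)) (f := fun k ω => g k ω * Y k ω)
      (fun k hk => hprod k (Finset.mem_range.1 hk)) (h.filtration n)] with ω e1 e2 e3 e4
  refine e1.trans ?_
  rw [Pi.add_apply, e2, hAe, esum, e4, Finset.sum_apply, Finset.sum_congr rfl e3, Finset.mul_sum]

end OneStep

end IsEchoInput

/-! ### The echoed increments as an averaging process -/

namespace IsEchoInput

variable {Ω : Type*} [m0 : MeasurableSpace Ω] {μ : Measure Ω} {p : ℝ} {νX νξ : Measure ℝ}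
  {X ε ξ : ℕ → Ω → ℝ} {U : ℕ → Ω → ℕ} [IsProbabilityMeasure μ] {γ : ℝ}

/-- The generic step with `φ = ψ = |·|^γ`. Integrability is assumed of earlier increments only, so
that the result can drive the induction in `memLp_echoStep`. -/
theorem condExp_abs_echoStep_rpow (h : IsEchoInput μ p νX νξ X ε ξ U) (hp0 : 0 ≤ p) (hp1 : p ≤ 1)
    (hγ : 0 < γ) (hX : MemLp (fun x : ℝ => x) (ENNReal.ofReal γ) νX)
    (hξ : MemLp (fun x : ℝ => x) (ENNReal.ofReal γ) νξ) (n : ℕ)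
    (hy : ∀ k < n + 1, MemLp (echoStep X ε ξ U (k + 1)) (ENNReal.ofReal γ) μ) :
    Integrable (fun ω => |echoStep X ε ξ U (n + 2) ω| ^ γ) μ ∧
    μ[fun ω => |echoStep X ε ξ U (n + 2) ω| ^ γ | h.filtration n] =ᵐ[μ]
      fun ω => (1 - p) * (∫ x, |x| ^ γ ∂νX) + p * (∫ x, |x| ^ γ ∂νξ) / (n + 1 : ℝ) *
        ∑ k ∈ Finset.range (n + 1), |echoStep X ε ξ U (k + 1) ω| ^ γ := by
  have hm : Measurable fun x : ℝ => |x| ^ γ := continuous_abs.measurable.pow_const γ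
  obtain ⟨hi, hc⟩ := h.integrable_and_condExp_step hp0 hp1 hm (hX.integrable_abs_rpow hγ) hm
    (hξ.integrable_abs_rpow hγ) n (Y := fun k ω => |echoStep X ε ξ U (k + 1) ω| ^ γ)
    (fun k hk => (hm.comp ((h.stronglyAdapted_echoStep k).measurable.mono
      (h.filtration.mono (Nat.lt_succ_iff.1 hk)) le_rfl)).stronglyMeasurable)
    (fun k hk => (hy k hk).integrable_abs_rpow hγ)
  have hae := (h.ae_bern hp0 hp1 (show 2 ≤ n + 2 by omega)).mono
    fun ω hω => abs_echoStep_add_two_rpow X ε ξ U hγ n ω hω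
  exact ⟨hi.congr (hae.mono fun ω hω => hω.symm), (condExp_congr_ae hae).trans hc⟩

theorem memLp_echoStep (h : IsEchoInput μ p νX νξ X ε ξ U) (hp0 : 0 ≤ p) (hp1 : p ≤ 1)
    (hγ : 0 < γ) (hX : MemLp (fun x : ℝ => x) (ENNReal.ofReal γ) νX)
    (hξ : MemLp (fun x : ℝ => x) (ENNReal.ofReal γ) νξ) (n : ℕ) :
    MemLp (echoStep X ε ξ U (n + 1)) (ENNReal.ofReal γ) μ := by
  induction n using Nat.strong_induction_on with
  | _ n ih =>
    have hsm := ((h.stronglyAdapted_echoStep n).mono (h.filtration.le n)).aestronglyMeasurable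
      (μ := μ)
    rw [← integrable_norm_rpow_iff hsm (by simpa using hγ) ENNReal.ofReal_ne_top,
      ENNReal.toReal_ofReal hγ.le]
    rcases n with _ | n
    · simp only [zero_add, echoStep_one]
      exact h.integrable_comp_spin (continuous_norm.measurable.pow_const γ)
        (hX.integrable_abs_rpow hγ) le_rfl
    · exact (h.condExp_abs_echoStep_rpow hp0 hp1 hγ hX hξ n ih).1

theorem isAveraging (h : IsEchoInput μ p νX νξ X ε ξ U) (hp0 : 0 ≤ p) (hp1 : p ≤ 1)
    (hγ1 : 1 < γ) (hγ2 : γ ≤ 2) (hX : MemLp (fun x : ℝ => x) (ENNReal.ofReal γ) νX)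
    (hξ : MemLp (fun x : ℝ => x) (ENNReal.ofReal γ) νξ) (hpγ : p * ∫ x, |x| ^ γ ∂νξ < γ)
    [IsProbabilityMeasure νX] [IsProbabilityMeasure νξ] :
    IsAveraging μ h.filtration (fun n => echoStep X ε ξ U (n + 1)) γ
      ((1 - p) * ∫ x, x ∂νX) (p * ∫ x, x ∂νξ) ((1 - p) * ∫ x, |x| ^ γ ∂νX)
      (p * ∫ x, |x| ^ γ ∂νξ) := by
  have hγ : 0 < γ := by linarith
  have h1 : 1 ≤ ENNReal.ofReal γ := by simpa using hγ1.le
  have hL := h.memLp_echoStep hp0 hp1 hγ hX hξ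
  refine ⟨hγ1, hγ2, h.stronglyAdapted_echoStep, hL,
    mul_nonneg (by linarith) (integral_nonneg fun x => by positivity),
    mul_nonneg hp0 (integral_nonneg fun x => by positivity), hpγ, fun n => ?_, fun n => ?_⟩
  · have := (h.integrable_and_condExp_step hp0 hp1 measurable_id (hX.integrable h1) measurable_id
      (hξ.integrable h1) n (Y := fun k => echoStep X ε ξ U (k + 1))
      (fun k hk => (h.stronglyAdapted_echoStep k).mono (h.filtration.mono (Nat.lt_succ_iff.1 hk)))
      (fun k _ => (hL k).integrable h1)).2
    have e : echoStep X ε ξ U (n + 1 + 1) = _ := funext fun ω => echoStep_add_two X ε ξ U n ω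
    simp only [e]
    exact this
  · have hc := (h.condExp_abs_echoStep_rpow hp0 hp1 hγ hX hξ n fun k _ => hL k).2
    rw [← integral_condExp (h.filtration.le n), integral_congr_ae hc,
      integral_add (integrable_const _) ((integrable_finsetSum _ fun k _ =>
        (hL k).integrable_abs_rpow hγ).const_mul _), integral_const_mul, integral_const_mul,
      integral_finsetSum _ fun k _ => (hL k).integrable_abs_rpow hγ]
    simp

theorem memLp_echoWalk_div (h : IsEchoInput μ p νX νξ X ε ξ U) (hp0 : 0 ≤ p) (hp1 : p ≤ 1)
    (hγ : 0 < γ) (hX : MemLp (fun x : ℝ => x) (ENNReal.ofReal γ) νX)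
    (hξ : MemLp (fun x : ℝ => x) (ENNReal.ofReal γ) νξ) (b : ℝ) (n : ℕ) :
    MemLp (fun ω => echoWalk X ε ξ U n ω / b) (ENNReal.ofReal γ) μ := by
  simp only [echoWalk_eq_sum_range, div_eq_inv_mul]
  exact (memLp_finsetSum _ fun k _ => h.memLp_echoStep hp0 hp1 hγ hX hξ k).const_mul _

end IsEchoInput

/-! ### The two limit theorems -/

theorem theorem2 (p : ℝ) (hp0 : 0 < p) (hp1 : p ≤ 1)
    (νX νξ : Measure ℝ) [IsProbabilityMeasure νX] [IsProbabilityMeasure νξ]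
    (hX : νX {0} < 1) (hξ : νξ {0} < 1) (hξnonneg : ∀ᵐ x ∂νξ, 0 ≤ x)
    (hmom : ∃ α : ℝ, 1 < α ∧ MemLp (fun x : ℝ => x) (ENNReal.ofReal α) νX ∧
      MemLp (fun x : ℝ => x) (ENNReal.ofReal α) νξ)
    (hpm : p * (∫ x, x ∂νξ) ≤ 1) :
    ∃ γ : ℝ, 1 < γ ∧
      ∀ {Ω : Type*} [MeasurableSpace Ω] (μ : Measure Ω) [IsProbabilityMeasure μ]
        (X ε ξ : ℕ → Ω → ℝ) (U : ℕ → Ω → ℕ), IsEchoInput μ p νX νξ X ε ξ U →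
        (p * (∫ x, x ∂νξ) = 1 → (∫ x, x * Real.log x ∂νξ) < ∫ x, x ∂νξ →
          TendstoASAndLp μ γ
            (fun n ω => echoWalk X ε ξ U n ω / ((n : ℝ) * Real.log n))
            ((1 - p) * ∫ x, x ∂νX)) ∧
        (p * (∫ x, x ∂νξ) < 1 →
          TendstoASAndLp μ γ
            (fun n ω => echoWalk X ε ξ U n ω / (n : ℝ))
            ((1 - p) * (∫ x, x ∂νX) / (1 - p * ∫ x, x ∂νξ))) := by
  obtain ⟨α, hα, hXα, hξα⟩ := hmom
  -- The exponent must be fixed before the probability space, from `p` and the laws alone. When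
  -- neither regime applies, both claims are vacuous and any `γ > 1` will do.
  by_cases hcase : p * (∫ x, x ∂νξ) < 1 ∨
      p * (∫ x, x ∂νξ) = 1 ∧ (∫ x, x * Real.log x ∂νξ) < ∫ x, x ∂νξ
  swap
  · push Not at hcase
    exact ⟨2, one_lt_two, fun μ _ X ε ξ U _ =>
      ⟨fun h1 h2 => absurd h2 (hcase.2 h1).not_gt, fun h1 => absurd h1 hcase.1.not_gt⟩⟩
  obtain ⟨γ, hγ1, hγ2, hγα, hpγ⟩ := exists_exponent hξnonneg hp0 hα hξα hcase
  have hγ : 0 < γ := by linarith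
  have hXγ := hXα.mono_exponent (ENNReal.ofReal_le_ofReal hγα)
  have hξγ := hξα.mono_exponent (ENNReal.ofReal_le_ofReal hγα)
  refine ⟨γ, hγ1, fun μ _ X ε ξ U h => ⟨fun h1 _ => ?_, fun h1 => ?_⟩⟩
  · have hav := h.isAveraging hp0.le hp1 hγ1 hγ2 hXγ hξγ hpγ
    rw [h1] at hav
    refine ⟨?_, fun n => h.memLp_echoWalk_div hp0.le hp1 hγ hXγ hξγ _ n, ?_⟩
    · filter_upwards [hav.tendsto_average_div_log.1] with ω hω
      -- The averaging process at index `n` involves `n + 1` increments, that is, the walk at time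
      -- `n + 1`.
      rw [← tendsto_add_atTop_iff_nat 1]
      simpa only [echoWalk_eq_sum_range, Nat.cast_add, Nat.cast_one] using hω
    · rw [← tendsto_add_atTop_iff_nat 1]
      simpa only [echoWalk_eq_sum_range, Nat.cast_add, Nat.cast_one] using
        hav.tendsto_average_div_log.2
  · have hav := (h.isAveraging hp0.le hp1 hγ1 hγ2 hXγ hξγ hpγ).tendsto_average
      (mul_nonneg hp0.le (integral_nonneg_of_ae hξnonneg)) h1
    refine ⟨?_, fun n => h.memLp_echoWalk_div hp0.le hp1 hγ hXγ hξγ _ n, ?_⟩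
    · filter_upwards [hav.1] with ω hω
      rw [← tendsto_add_atTop_iff_nat 1]
      simpa only [echoWalk_eq_sum_range, Nat.cast_add, Nat.cast_one] using hω
    · rw [← tendsto_add_atTop_iff_nat 1]
      simpa only [echoWalk_eq_sum_range, Nat.cast_add, Nat.cast_one] using hav.2
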